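/- Let $\Omega\subset\mathbb R^2$ be a convex open set which is invariant under $\sigma_1(x,y)=(-x,y)$ and $\sigma_2(x,y)=(x,-y)$ and satisfies, for some $a,b>0$, $$\Omega\cap\{y=0\}=\left]-\tfrac a2,\tfrac a2\right[\times\{0\},\qquad \Omega\cap\{x=0\}=\{0\}\times\left]-\tfrac b2,\tfrac b2\right[ .$$ Let $\dot\Omega=\Omega\setminus\{0\}$, and let $-\Delta_{\mathbf A}=(D_x-A_1)^2+(D_y-A_2)^2$ be the Dirichlet Aharonov–Bohm operator on $\dot\Omega$ with flux $\tfrac12$ at the origin, that is, the Friedrichs extension of this differential operator on $C_c^\infty(\dot\Omega;\mathbb C)$ in $L^2(\dot\Omega;\mathbb C)$, where $D_x=-i\partial_x$, $D_y=-i\partial_y$, $(A_1,A_2)=\tfrac12\left(-\tfrac{y}{r^2},\tfrac{x}{r^2}\right)$ and $r^2=x^2+y^2$. For an open set $D$ and $N\subset\partial D$, the Dirichlet–Neumann Laplacian on $D$ with Neumann part $N$ is the self-adjoint operator in $L^2(D;\mathbb C)$ associated with the form $\int_D\nabla u\cdot\overline{\nabla v}$ on the closure in $H^1(D)$ of the restrictions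 to $D$ of those functions in $C_c^\infty(\mathbb R^2;\mathbb C)$ whose support does not meet $\overline{\partial D\setminus N}$ (Neumann condition on $N$, Dirichlet condition on $\partial D\setminus N$). Then the following problems have the same set of eigenvalues: - the Dirichlet problem for the Aharonov–Bohm operator $-\Delta_{\mathbf A}$ on $\dot\Omega$; - the Dirichlet–Neumann problem for the Laplacian on the upper half-domain $\Omega\cap\{y>0\}$, with Neumann part $N$; - the Dirichlet–Neumann problem for the Laplacian on the lower half-domain $\Omega\cap\{y<0\}$, with Neumann part $N$; - the Dirichlet–Neumann problem for the Laplacian on the left half-domain $\Omega\cap\{x<0\}$, with Neumann part $M$; - the Dirichlet–Neumann problem for the Laplacian on the right half-domain $\Omega\cap\{x>0\}$, with Neumann part $M$. Here $N$ may be either of the segments $\left]0,\tfrac a2\right]\times\{0\}$ and $\left[-\tfrac a2,0\right[\times\{0\}$, and $M$ either of the segments $\{0\}\times\left]0,\tfrac b2\right]$ and $\{0\}\times\left[-\tfrac b2,0\right[$. -/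

import Mathlib

open MeasureTheory Set

open scoped ContDiff ENNReal ComplexConjugate

/-! ## The operator associated with the closure of a first-order quadratic form

Let `𝒟` be a class of smooth functions on the plane and `P₁ φ, P₂ φ` first-order differential
expressions.  On `L²(D; ℂ)` we consider the non-negative form
`q(φ, ψ) = ∫_D P₁ φ * conj (P₁ ψ) + P₂ φ * conj (P₂ ψ)` on `𝒟`, its closure, and
the self-adjoint operator associated with the closure. -/

/-- `(u, g₁, g₂)` is a limit, in `L²(D)³`, of triples `(φ, P₁ φ, P₂ φ)` with `φ ∈ 𝒟`.
Thus `u` is in the domain of the closure of the form `q`, and `(g₁, g₂)` is the extension of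
`(P₁, P₂)` to `u`. -/
def InFormClosure (D : Set (ℝ × ℝ)) (𝒟 : Set (ℝ × ℝ → ℂ))
    (P₁ P₂ : (ℝ × ℝ → ℂ) → (ℝ × ℝ → ℂ)) (u g₁ g₂ : ℝ × ℝ → ℂ) : Prop :=
  MemLp u 2 (volume.restrict D) ∧ MemLp g₁ 2 (volume.restrict D) ∧
  MemLp g₂ 2 (volume.restrict D) ∧
  ∀ ε : ℝ≥0∞, 0 < ε → ∃ φ ∈ 𝒟,
    eLpNorm (u - φ) 2 (volume.restrict D) < ε ∧
    eLpNorm (g₁ - P₁ φ) 2 (volume.restrict D) < ε ∧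
    eLpNorm (g₂ - P₂ φ) 2 (volume.restrict D) < ε

/-- The graph of the operator `H` associated with the closure of the form `q`: `u` is in the
domain of `H` and `H u = f`, that is, `u` is in the form domain, `f ∈ L²(D)` and
`q(u, φ) = ⟨f, φ⟩` for all `φ` in the form core `𝒟`. -/
def IsFormOperator (D : Set (ℝ × ℝ)) (𝒟 : Set (ℝ × ℝ → ℂ))
    (P₁ P₂ : (ℝ × ℝ → ℂ) → (ℝ × ℝ → ℂ)) (u f : ℝ × ℝ → ℂ) : Prop :=
  MemLp f 2 (volume.restrict D) ∧
  ∃ g₁ g₂ : ℝ × ℝ → ℂ, InFormClosure D 𝒟 P₁ P₂ u g₁ g₂ ∧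
    ∀ φ ∈ 𝒟, ∫ p in D, (g₁ p * conj (P₁ φ p) + g₂ p * conj (P₂ φ p))
      = ∫ p in D, f p * conj (φ p)

/-- The eigenvalues of the operator associated with the closure of the form `q`. -/
def formEigenvalues (D : Set (ℝ × ℝ)) (𝒟 : Set (ℝ × ℝ → ℂ))
    (P₁ P₂ : (ℝ × ℝ → ℂ) → (ℝ × ℝ → ℂ)) : Set ℂ :=
  {z | ∃ u : ℝ × ℝ → ℂ, ¬ u =ᵐ[volume.restrict D] 0 ∧
    IsFormOperator D 𝒟 P₁ P₂ u (fun p => z * u p)}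

/-! ## The Aharonov–Bohm operator -/

/-- The partial derivative `∂φ/∂x`. -/
noncomputable def partialX (φ : ℝ × ℝ → ℂ) (p : ℝ × ℝ) : ℂ := fderiv ℝ φ p (1, 0)

/-- The partial derivative `∂φ/∂y`. -/
noncomputable def partialY (φ : ℝ × ℝ → ℂ) (p : ℝ × ℝ) : ℂ := fderiv ℝ φ p (0, 1)

/-- The first component `-y / (2 r²)` of the potential with flux `1/2` at the origin. -/
noncomputable def potentialX (p : ℝ × ℝ) : ℝ := 1 / 2 * (-p.2 / (p.1 ^ 2 + p.2 ^ 2))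

/-- The second component `x / (2 r²)` of the potential with flux `1/2` at the origin. -/
noncomputable def potentialY (p : ℝ × ℝ) : ℝ := 1 / 2 * (p.1 / (p.1 ^ 2 + p.2 ^ 2))

/-- `(D_x - A₁) φ`, where `D_x = -i ∂_x`. -/
noncomputable def magneticX (φ : ℝ × ℝ → ℂ) (p : ℝ × ℝ) : ℂ :=
  -Complex.I * partialX φ p - (potentialX p : ℂ) * φ p

/-- `(D_y - A₂) φ`, where `D_y = -i ∂_y`. -/
noncomputable def magneticY (φ : ℝ × ℝ → ℂ) (p : ℝ × ℝ) : ℂ :=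
  -Complex.I * partialY φ p - (potentialY p : ℂ) * φ p

/-- The differential expression `-Δ_A = (D_x - A₁)² + (D_y - A₂)²`. -/
noncomputable def abLaplacian (φ : ℝ × ℝ → ℂ) (p : ℝ × ℝ) : ℂ :=
  magneticX (magneticX φ) p + magneticY (magneticY φ) p

/-- The space `C_c^∞(U)` of smooth complex functions with compact support in `U`. -/
def testFunctions (U : Set (ℝ × ℝ)) : Set (ℝ × ℝ → ℂ) :=
  {φ | ContDiff ℝ ∞ φ ∧ HasCompactSupport φ ∧ tsupport φ ⊆ U}

/-! ### The quadratic form of `-Δ_A` -/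

/-- A first-order expression `-i ∂_v - c`; both `magneticX` and `magneticY` are of this shape. -/
noncomputable def magneticDeriv (v : ℝ × ℝ) (c : ℝ × ℝ → ℝ) (φ : ℝ × ℝ → ℂ) (p : ℝ × ℝ) : ℂ :=
  -Complex.I * fderiv ℝ φ p v - (c p : ℂ) * φ p

theorem magneticDeriv_mem_testFunctions {U : Set (ℝ × ℝ)} (v : ℝ × ℝ) {c : ℝ × ℝ → ℝ}
    (hc : ∀ p ∈ U, ContDiffAt ℝ ∞ c p) {φ : ℝ × ℝ → ℂ} (hφ : φ ∈ testFunctions U) :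
    magneticDeriv v c φ ∈ testFunctions U := by
  obtain ⟨hs, hcomp, hsub⟩ := hφ
  have hsupp : tsupport (magneticDeriv v c φ) ⊆ tsupport φ := by
    refine closure_minimal (fun p hp => ?_) (isClosed_tsupport φ)
    by_contra hn
    apply hp
    have h1 : φ p = 0 := image_eq_zero_of_notMem_tsupport hn
    have h2 : fderiv ℝ φ p = 0 :=
      image_eq_zero_of_notMem_tsupport (fun h => hn (tsupport_fderiv_subset ℝ h))
    simp [magneticDeriv, h1, h2]
  refine ⟨?_, ?_, hsupp.trans hsub⟩
  · rw [contDiff_iff_contDiffAt]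
    intro p
    by_cases hp : p ∈ tsupport φ
    · have h1 : ContDiffAt ℝ ∞ (fun q => (c q : ℂ)) p :=
        Complex.ofRealCLM.contDiff.contDiffAt.comp p (hc p (hsub hp))
      have h2 : ContDiff ℝ ∞ (fun q => fderiv ℝ φ q v) :=
        (hs.fderiv_right (m := ∞) (by simp)).clm_apply contDiff_const
      exact (contDiffAt_const.mul h2.contDiffAt).sub (h1.mul hs.contDiffAt)
    · have : p ∉ tsupport (magneticDeriv v c φ) := fun h => hp (hsupp h)
      have h0 : magneticDeriv v c φ =ᶠ[nhds p] 0 := notMem_tsupport_iff_eventuallyEq.1 this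
      exact contDiffAt_const.congr_of_eventuallyEq h0
  · exact hcomp.of_isClosed_subset (isClosed_tsupport _) hsupp

theorem integral_magneticDeriv_mul_conj {U : Set (ℝ × ℝ)} (v : ℝ × ℝ) {c : ℝ × ℝ → ℝ}
    (hc : ∀ p ∈ U, ContDiffAt ℝ ∞ c p) {φ ψ : ℝ × ℝ → ℂ} (hφ : φ ∈ testFunctions U)
    (hψ : ψ ∈ testFunctions U) :
    ∫ p, magneticDeriv v c φ p * conj (ψ p) = ∫ p, φ p * conj (magneticDeriv v c ψ p) := by
  have hM := magneticDeriv_mem_testFunctions v hc hφ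
  have hM' := magneticDeriv_mem_testFunctions v hc hψ
  have hdφ : Continuous (fun p => fderiv ℝ φ p v) :=
    (hφ.1.continuous_fderiv (by simp)).clm_apply continuous_const
  have hdψ : Continuous (fun p => fderiv ℝ ψ p v) :=
    (hψ.1.continuous_fderiv (by simp)).clm_apply continuous_const
  have hcψ : Continuous (fun p => conj (ψ p)) := Complex.continuous_conj.comp hψ.1.continuous
  have hcdψ : Continuous (fun p => conj (fderiv ℝ ψ p v)) := Complex.continuous_conj.comp hdψ
  have hfd : ∀ p, fderiv ℝ (fun p => conj (ψ p)) p v = conj (fderiv ℝ ψ p v) := by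
    intro p
    have hd : HasFDerivAt ψ (fderiv ℝ ψ p) p :=
      (hψ.1.differentiable (by simp) p).hasFDerivAt
    have h := (Complex.conjCLE.toContinuousLinearMap.hasFDerivAt (x := ψ p)).comp p hd
    have h' : fderiv ℝ (fun p => conj (ψ p)) p
        = Complex.conjCLE.toContinuousLinearMap.comp (fderiv ℝ ψ p) := h.fderiv
    rw [h']; rfl
  have hsφ : HasCompactSupport (fun p => fderiv ℝ φ p v) := hφ.2.1.fderiv_apply ℝ v
  have i1 : Integrable (fun p => conj (fderiv ℝ ψ p v) * φ p) :=
    (hcdψ.mul hφ.1.continuous).integrable_of_hasCompactSupport hφ.2.1.mul_left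
  have i2 : Integrable (fun p => conj (ψ p) * fderiv ℝ φ p v) :=
    (hcψ.mul hdφ).integrable_of_hasCompactSupport hsφ.mul_left
  have i3 : Integrable (fun p => conj (ψ p) * φ p) :=
    (hcψ.mul hφ.1.continuous).integrable_of_hasCompactSupport hφ.2.1.mul_left
  have i4 : Integrable (fun p => magneticDeriv v c φ p * conj (ψ p)) :=
    (hM.1.continuous.mul hcψ).integrable_of_hasCompactSupport hM.2.1.mul_right
  have i5 : Integrable (fun p => φ p * conj (magneticDeriv v c ψ p)) :=
    (hφ.1.continuous.mul (Complex.continuous_conj.comp hM'.1.continuous)).integrable_of_hasCompactSupport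
      hφ.2.1.mul_right
  have key := integral_mul_fderiv_eq_neg_fderiv_mul_of_integrable (μ := volume) (v := v)
    (f := fun p => conj (ψ p)) (g := φ) (by simpa only [hfd] using i1) i2 i3
    (fun p _ => (Complex.conjCLE.toContinuousLinearMap.differentiableAt).comp p
      (hψ.1.differentiable (by simp) p))
    (fun p _ => hφ.1.differentiable (by simp) p)
  simp only [hfd] at key
  rw [← sub_eq_zero, ← integral_sub i4 i5]
  have e : ∀ p, magneticDeriv v c φ p * conj (ψ p) - φ p * conj (magneticDeriv v c ψ p)
      = -Complex.I * (conj (ψ p) * fderiv ℝ φ p v + conj (fderiv ℝ ψ p v) * φ p) := by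
    intro p
    simp only [magneticDeriv, map_sub, map_mul, map_neg, Complex.conj_I, Complex.conj_ofReal]
    ring
  simp only [e]
  rw [integral_const_mul, integral_add i2 i1, key]
  simp

theorem contDiffAt_potentialX {p : ℝ × ℝ} (hp : p ≠ 0) : ContDiffAt ℝ ∞ potentialX p := by
  have h : p.1 ^ 2 + p.2 ^ 2 ≠ 0 := fun h => hp (by
    ext
    · simpa using (by nlinarith [sq_nonneg p.1, sq_nonneg p.2] : p.1 ^ 2 = 0)
    · simpa using (by nlinarith [sq_nonneg p.1, sq_nonneg p.2] : p.2 ^ 2 = 0))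
  exact contDiffAt_const.mul (contDiffAt_snd.neg.div
    ((contDiffAt_fst.pow 2).add (contDiffAt_snd.pow 2)) h)

theorem contDiffAt_potentialY {p : ℝ × ℝ} (hp : p ≠ 0) : ContDiffAt ℝ ∞ potentialY p := by
  have h : p.1 ^ 2 + p.2 ^ 2 ≠ 0 := fun h => hp (by
    ext
    · simpa using (by nlinarith [sq_nonneg p.1, sq_nonneg p.2] : p.1 ^ 2 = 0)
    · simpa using (by nlinarith [sq_nonneg p.1, sq_nonneg p.2] : p.2 ^ 2 = 0))
  exact contDiffAt_const.mul (contDiffAt_fst.div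
    ((contDiffAt_fst.pow 2).add (contDiffAt_snd.pow 2)) h)

/-- On `C_c^∞(Ω \ {0})` the form `⟨-Δ_A φ, ψ⟩` is the form that defines `abEigenvalues`. -/
theorem integral_abLaplacian_mul_conj {Ω : Set (ℝ × ℝ)} {φ ψ : ℝ × ℝ → ℂ}
    (hφ : φ ∈ testFunctions (Ω \ {0})) (hψ : ψ ∈ testFunctions (Ω \ {0})) :
    ∫ p in Ω \ {0}, abLaplacian φ p * conj (ψ p)
      = ∫ p in Ω \ {0}, (magneticX φ p * conj (magneticX ψ p)
          + magneticY φ p * conj (magneticY ψ p)) := by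
  have hcX : ∀ p ∈ Ω \ {0}, ContDiffAt ℝ ∞ potentialX p :=
    fun p hp => contDiffAt_potentialX hp.2
  have hcY : ∀ p ∈ Ω \ {0}, ContDiffAt ℝ ∞ potentialY p :=
    fun p hp => contDiffAt_potentialY hp.2
  have mX : ∀ {χ}, χ ∈ testFunctions (Ω \ {0}) → magneticX χ ∈ testFunctions (Ω \ {0}) :=
    fun h => magneticDeriv_mem_testFunctions (1, 0) hcX h
  have mY : ∀ {χ}, χ ∈ testFunctions (Ω \ {0}) → magneticY χ ∈ testFunctions (Ω \ {0}) :=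
    fun h => magneticDeriv_mem_testFunctions (0, 1) hcY h
  have hint : ∀ {f g}, f ∈ testFunctions (Ω \ {0}) → g ∈ testFunctions (Ω \ {0}) →
      Integrable (fun p => f p * conj (g p)) := fun hf hg =>
    (hf.1.continuous.mul (Complex.continuous_conj.comp hg.1.continuous)
      ).integrable_of_hasCompactSupport hf.2.1.mul_right
  have hz : ∀ {f}, f ∈ testFunctions (Ω \ {0}) → ∀ p, p ∉ Ω \ {0} → f p = 0 :=
    fun hf p hp => image_eq_zero_of_notMem_tsupport (fun h => hp (hf.2.2 h))
  rw [setIntegral_eq_integral_of_forall_compl_eq_zero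
      (fun p hp => by rw [hz hψ p hp]; simp),
    setIntegral_eq_integral_of_forall_compl_eq_zero
      (fun p hp => by rw [hz (mX hφ) p hp, hz (mY hφ) p hp]; simp),
    integral_add (hint (mX hφ) (mX hψ)) (hint (mY hφ) (mY hψ))]
  have e1 : ∫ p, magneticX (magneticX φ) p * conj (ψ p)
      = ∫ p, magneticX φ p * conj (magneticX ψ p) :=
    integral_magneticDeriv_mul_conj (1, 0) hcX (mX hφ) hψ
  have e2 : ∫ p, magneticY (magneticY φ) p * conj (ψ p)
      = ∫ p, magneticY φ p * conj (magneticY ψ p) :=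
    integral_magneticDeriv_mul_conj (0, 1) hcY (mY hφ) hψ
  rw [← e1, ← e2, ← integral_add (hint (mX (mX hφ)) hψ) (hint (mY (mY hφ)) hψ)]
  simp only [abLaplacian, add_mul]

/-- The eigenvalues of the Dirichlet realization of the Aharonov–Bohm operator `-Δ_A` on the
punctured domain `Ω \ {0}`, that is, of the Friedrichs extension of `-Δ_A` on
`C_c^∞(Ω \ {0})`: the operator associated with the closure of the form
`⟨-Δ_A φ, ψ⟩ = ⟨(D_x - A₁) φ, (D_x - A₁) ψ⟩ + ⟨(D_y - A₂) φ, (D_y - A₂) ψ⟩`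
on `C_c^∞(Ω \ {0})` (for this identity see `integral_abLaplacian_mul_conj`). -/
def abEigenvalues (Ω : Set (ℝ × ℝ)) : Set ℂ :=
  formEigenvalues (Ω \ {0}) (testFunctions (Ω \ {0})) magneticX magneticY

/-! ## The mixed Dirichlet–Neumann Laplacian -/

/-- The restrictions to `D` of these functions form the usual core of the mixed problem on `D`:
smooth functions, compactly supported in the plane, that vanish near the
Dirichlet part `∂D \ N` of the boundary. -/
def mixedTestFunctions (D N : Set (ℝ × ℝ)) : Set (ℝ × ℝ → ℂ) :=
  {φ | ContDiff ℝ ∞ φ ∧ HasCompactSupport φ ∧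
    Disjoint (tsupport φ) (closure (frontier D \ N))}

/-- The eigenvalues of the realization of `-Δ` in `D` with the Neumann condition on `N ⊆ ∂D` and
the Dirichlet condition on `∂D \ N`, i.e. of the operator associated with the Dirichlet form
`∫_D ∇u · conj (∇v)` on the closure in `H¹(D)` of the functions vanishing near `∂D \ N`. -/
def mixedEigenvalues (D N : Set (ℝ × ℝ)) : Set ℂ :=
  formEigenvalues D (mixedTestFunctions D N) partialX partialY

/-! ## The half-domains -/

/-- `Ω ∩ {y > 0}`. -/
def upperHalf (Ω : Set (ℝ × ℝ)) : Set (ℝ × ℝ) := Ω ∩ {p | 0 < p.2}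

/-- `Ω ∩ {y < 0}`. -/
def lowerHalf (Ω : Set (ℝ × ℝ)) : Set (ℝ × ℝ) := Ω ∩ {p | p.2 < 0}

/-- `Ω ∩ {x < 0}`. -/
def leftHalf (Ω : Set (ℝ × ℝ)) : Set (ℝ × ℝ) := Ω ∩ {p | p.1 < 0}

/-- `Ω ∩ {x > 0}`. -/
def rightHalf (Ω : Set (ℝ × ℝ)) : Set (ℝ × ℝ) := Ω ∩ {p | 0 < p.1}

/-!
Let `f` be the reflection `(x, y) ↦ (x, -y)`, let `θ` be the polar angle and let `Ω` be a domain
with `f(Ω) = Ω`.  The reflection reverses the flux `1/2`, and multiplication by `e^{iθ}`, which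
shifts the flux by one, restores it; so `M u = e^{iθ} u ∘ f` is an involution that commutes with the
Aharonov–Bohm operator (`magnetic_phase_mul_comp`).  On the plane cut along `{x ≤ 0, y = 0}` the
potential is removed by the gauge `u = e^{iθ/2} v` (`magnetic_halfPhase_mul`), and `M u = u` says
that `v` is even in `y`.  Since `e^{iθ} = -1` on the negative half-axis and `e^{iθ} = 1` on the
positive one, `u` vanishes on the first and is unconstrained on the second.  So the restriction of `v` to the
upper half solves the mixed problem with the Neumann condition on the positive half-axis, and
conversely.

The correspondence is implemented by the maps `unfold` (from the upper half to `Ω \ {0}`) and `fold`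
(its adjoint).  `IsFormOperator.transfer` reduces the transport of eigenfunctions to the statement
that each of the two maps carries one form core into the closure of the other form.

* For `unfold` (`SymmetricDomain.inFormClosure_unfold`) the even extension `φ(x, |y|)` of a test
  function is approximated by the smooth functions `φ(x, √(y² + ε²))`.  These vanish near the cut
  and near `∂Ω`, because the folded boundary points belong to the closure of the Dirichlet part
  (`SymmetricDomain.abs_mem_closure_dirichlet`).
* For `fold` (`SymmetricDomain.inFormClosure_conj_halfPhase_mul`) the point is that a function that
  is smooth up to the boundary and is zero on the Dirichlet segment, hence `O(y)` there, can be cut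
  off in a strip of width `1/n` at bounded cost in the gradient.

Folding kills the eigenfunctions with `M u = -u`.  They are not lost: with `g(x, y) = (-x, y)`, the
map `u ↦ e^{iθ} u ∘ g` also commutes with the operator and anticommutes with `M`, so it exchanges
the two parities (`SymmetricDomain.ae_eq_zero_of_fold_eq_zero`).  The other choices of the half-domain
and of the Neumann segment follow by reflecting in the axes and in the diagonal.
-/

/-! ### Adjoint pairs of maps and transport of eigenfunctions -/

/-- Two linear maps between functions on `D` and functions on `D'` that are bounded and mutually
adjoint with respect to the `L²` norms and inner products.  They act on honest functions, so that
they can be evaluated pointwise on the smooth functions of a form core. -/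
structure L2Pair (D D' : Set (ℝ × ℝ)) (S T : (ℝ × ℝ → ℂ) →ₗ[ℂ] (ℝ × ℝ → ℂ)) : Prop where
  memLp : ∀ u, MemLp u 2 (volume.restrict D) → MemLp (S u) 2 (volume.restrict D')
  memLp' : ∀ w, MemLp w 2 (volume.restrict D') → MemLp (T w) 2 (volume.restrict D)
  bound : ∃ C : ℝ≥0∞, C ≠ ⊤ ∧ ∀ u, MemLp u 2 (volume.restrict D) →
    eLpNorm (S u) 2 (volume.restrict D') ≤ C * eLpNorm u 2 (volume.restrict D)
  bound' : ∃ C : ℝ≥0∞, C ≠ ⊤ ∧ ∀ w, MemLp w 2 (volume.restrict D') →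
    eLpNorm (T w) 2 (volume.restrict D) ≤ C * eLpNorm w 2 (volume.restrict D')
  adj : ∀ u w, MemLp u 2 (volume.restrict D) → MemLp w 2 (volume.restrict D') →
    ∫ p in D', S u p * conj (w p) = ∫ p in D, u p * conj (T w p)

theorem MeasureTheory.MemLp.integrable_mul_conj {α : Type*} [MeasurableSpace α] {μ : Measure α}
    {u w : α → ℂ} (hu : MemLp u 2 μ) (hw : MemLp w 2 μ) :
    Integrable (fun p => u p * conj (w p)) μ :=
  hu.integrable_mul (q := 2) hw.star

theorem norm_integral_mul_conj_le {α : Type*} [MeasurableSpace α] {μ : Measure α}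
    {u w : α → ℂ} (hu : MemLp u 2 μ) (hw : MemLp w 2 μ) :
    ‖∫ p, u p * conj (w p) ∂μ‖ₑ ≤ eLpNorm u 2 μ * eLpNorm w 2 μ := by
  refine (enorm_integral_le_lintegral_enorm _).trans ?_
  rw [← eLpNorm_one_eq_lintegral_enorm]
  have h := eLpNorm_smul_le_mul_eLpNorm (p := 2) (q := 2) (r := 1) (μ := μ)
    hw.star.1 hu.1
  rw [eLpNorm_star] at h
  exact h

namespace L2Pair

variable {D D' D'' : Set (ℝ × ℝ)} {S T S' T' : (ℝ × ℝ → ℂ) →ₗ[ℂ] (ℝ × ℝ → ℂ)}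

theorem symm (h : L2Pair D D' S T) : L2Pair D' D T S where
  memLp := h.memLp'
  memLp' := h.memLp
  bound := h.bound'
  bound' := h.bound
  adj := fun w u hw hu => by
    have := congrArg conj (h.adj u w hu hw)
    rw [← integral_conj, ← integral_conj] at this
    simp only [map_mul, Complex.conj_conj] at this
    simp only [mul_comm (T w _), mul_comm (w _)]
    exact this.symm

theorem trans (h : L2Pair D D' S T) (h' : L2Pair D' D'' S' T') :
    L2Pair D D'' (S' ∘ₗ S) (T ∘ₗ T') where
  memLp := fun u hu => h'.memLp _ (h.memLp _ hu)
  memLp' := fun u hu => h.memLp' _ (h'.memLp' _ hu)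
  bound := by
    obtain ⟨C, hC, hb⟩ := h.bound
    obtain ⟨C', hC', hb'⟩ := h'.bound
    refine ⟨C' * C, ENNReal.mul_ne_top hC' hC, fun u hu => ?_⟩
    rw [mul_assoc]
    exact (hb' _ (h.memLp _ hu)).trans (by gcongr; exact hb u hu)
  bound' := by
    obtain ⟨C, hC, hb⟩ := h.bound'
    obtain ⟨C', hC', hb'⟩ := h'.bound'
    refine ⟨C * C', ENNReal.mul_ne_top hC hC', fun u hu => ?_⟩
    rw [mul_assoc]
    exact (hb _ (h'.memLp' _ hu)).trans (by gcongr; exact hb' u hu)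
  adj := fun u w hu hw =>
    (h'.adj _ _ (h.memLp _ hu) hw).trans (h.adj _ _ hu (h'.memLp' _ hw))

theorem add (h : L2Pair D D' S T) (h' : L2Pair D D' S' T') :
    L2Pair D D' (S + S') (T + T') where
  memLp := fun u hu => (h.memLp u hu).add (h'.memLp u hu)
  memLp' := fun u hu => (h.memLp' u hu).add (h'.memLp' u hu)
  bound := by
    obtain ⟨C, hC, hb⟩ := h.bound
    obtain ⟨C', hC', hb'⟩ := h'.bound
    refine ⟨C + C', ENNReal.add_ne_top.2 ⟨hC, hC'⟩, fun u hu => ?_⟩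
    rw [add_mul]
    exact (eLpNorm_add_le (h.memLp u hu).1 (h'.memLp u hu).1 (by norm_num)).trans
      (add_le_add (hb u hu) (hb' u hu))
  bound' := by
    obtain ⟨C, hC, hb⟩ := h.bound'
    obtain ⟨C', hC', hb'⟩ := h'.bound'
    refine ⟨C + C', ENNReal.add_ne_top.2 ⟨hC, hC'⟩, fun u hu => ?_⟩
    rw [add_mul]
    exact (eLpNorm_add_le (h.memLp' u hu).1 (h'.memLp' u hu).1 (by norm_num)).trans
      (add_le_add (hb u hu) (hb' u hu))
  adj := fun u w hu hw => by
    simp only [LinearMap.add_apply, Pi.add_apply, add_mul, map_add, mul_add]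
    rw [integral_add ((h.memLp u hu).integrable_mul_conj hw)
        ((h'.memLp u hu).integrable_mul_conj hw),
      integral_add (hu.integrable_mul_conj (h.memLp' w hw))
        (hu.integrable_mul_conj (h'.memLp' w hw)), h.adj u w hu hw, h'.adj u w hu hw]

theorem refl : L2Pair D D LinearMap.id LinearMap.id where
  memLp := fun _ hu => hu
  memLp' := fun _ hu => hu
  bound := ⟨1, by simp, fun u _ => by simp⟩
  bound' := ⟨1, by simp, fun u _ => by simp⟩
  adj := fun _ _ _ _ => rfl

/-- Multiplication by a measurable function bounded by one. -/
theorem mul {c : ℝ × ℝ → ℂ} (hc : Measurable c) (hc1 : ∀ p, ‖c p‖ ≤ 1) :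
    L2Pair D D (LinearMap.mulLeft ℂ c) (LinearMap.mulLeft ℂ (star c)) := by
  have key : ∀ {c : ℝ × ℝ → ℂ}, Measurable c → (∀ p, ‖c p‖ ≤ 1) → ∀ u,
      MemLp u 2 (volume.restrict D) → MemLp (c * u) 2 (volume.restrict D) ∧
      eLpNorm (c * u) 2 (volume.restrict D) ≤ 1 * eLpNorm u 2 (volume.restrict D) := by
    intro c hc hc1 u hu
    have h : ∀ p, ‖(c * u) p‖ ≤ ‖u p‖ := fun p => by
      rw [Pi.mul_apply, norm_mul]
      exact mul_le_of_le_one_left (norm_nonneg _) (hc1 p)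
    exact ⟨hu.of_le (hc.aestronglyMeasurable.mul hu.1) (.of_forall h),
      by rw [one_mul]; exact eLpNorm_mono h⟩
  have hc' : Measurable (star c) := continuous_star.measurable.comp hc
  have hc1' : ∀ p, ‖star c p‖ ≤ 1 := fun p => by simpa using hc1 p
  refine ⟨fun u hu => (key hc hc1 u hu).1, fun u hu => (key hc' hc1' u hu).1,
    ⟨1, by simp, fun u hu => (key hc hc1 u hu).2⟩,
    ⟨1, by simp, fun u hu => (key hc' hc1' u hu).2⟩, fun u w hu hw => ?_⟩
  congr 1
  ext p
  simp
  ring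

/-- Composition with a measure preserving involution. -/
theorem comp {f : (ℝ × ℝ) ≃L[ℝ] (ℝ × ℝ)} (hf : MeasurePreserving f volume volume)
    (hinv : Function.Involutive f) (hD : MeasurableSet D) :
    L2Pair D (f ⁻¹' D) (LinearMap.funLeft ℂ ℂ f) (LinearMap.funLeft ℂ ℂ f) := by
  have h1 : MeasurePreserving f (volume.restrict (f ⁻¹' D)) (volume.restrict D) :=
    hf.restrict_preimage hD
  have h2 : MeasurePreserving f (volume.restrict D) (volume.restrict (f ⁻¹' D)) := by
    have := hf.restrict_preimage (s := f ⁻¹' D) (f.continuous.measurable hD)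
    rwa [← preimage_comp, hinv.comp_self, preimage_id] at this
  refine ⟨fun u hu => hu.comp_measurePreserving h1, fun u hu => hu.comp_measurePreserving h2,
    ⟨1, by simp, fun u hu => ?_⟩, ⟨1, by simp, fun u hu => ?_⟩, fun u w hu hw => ?_⟩
  · rw [one_mul]
    exact (eLpNorm_comp_measurePreserving hu.1 h1).le
  · rw [one_mul]
    exact (eLpNorm_comp_measurePreserving hu.1 h2).le
  · rw [← h1.integral_comp f.toHomeomorph.measurableEmbedding]
    simp [LinearMap.funLeft_apply, hinv _]

/-- Extension by zero, with the restriction as its adjoint. -/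
theorem extend (hD : MeasurableSet D) (hDD : D ⊆ D') :
    L2Pair D D' (LinearMap.mulLeft ℂ (D.indicator 1)) LinearMap.id := by
  have e : ∀ u : ℝ × ℝ → ℂ, LinearMap.mulLeft ℂ (D.indicator (1 : ℝ × ℝ → ℂ)) u
      = D.indicator u := fun u => by
    ext p
    by_cases hp : p ∈ D <;> simp [hp]
  have hr : (volume.restrict D').restrict D = (volume.restrict D : Measure (ℝ × ℝ)) := by
    rw [Measure.restrict_restrict hD, inter_eq_left.2 hDD]
  have hle : (volume.restrict D : Measure (ℝ × ℝ)) ≤ volume.restrict D' :=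
    Measure.restrict_mono hDD le_rfl
  refine ⟨fun u hu => ?_, fun w hw => hw.mono_measure hle, ⟨1, by simp, fun u hu => ?_⟩,
    ⟨1, by simp, fun w hw => ?_⟩, fun u w hu hw => ?_⟩
  · rw [e, memLp_indicator_iff_restrict hD, hr]
    exact hu
  · rw [e, eLpNorm_indicator_eq_eLpNorm_restrict hD, hr, one_mul]
  · rw [one_mul]
    exact eLpNorm_mono_measure _ hle
  · rw [e]
    have : ∀ p, D.indicator u p * conj (w p) = D.indicator (fun p => u p * conj (w p)) p :=
      fun p => by by_cases hp : p ∈ D <;> simp [hp]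
    simp only [this]
    rw [integral_indicator hD, hr]
    rfl

end L2Pair

/-- Every element of the core is square integrable on `D`, and so are its two first-order
expressions. -/
def CoreMemLp (D : Set (ℝ × ℝ)) (𝒟 : Set (ℝ × ℝ → ℂ))
    (P₁ P₂ : (ℝ × ℝ → ℂ) → (ℝ × ℝ → ℂ)) : Prop :=
  ∀ φ ∈ 𝒟, MemLp φ 2 (volume.restrict D) ∧ MemLp (P₁ φ) 2 (volume.restrict D) ∧
    MemLp (P₂ φ) 2 (volume.restrict D)

section Forms

variable {D D' : Set (ℝ × ℝ)} {𝒟 𝒟' : Set (ℝ × ℝ → ℂ)}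
  {P₁ P₂ P₁' P₂' : (ℝ × ℝ → ℂ) → (ℝ × ℝ → ℂ)}

theorem inFormClosure_of_ae_eq (hm : CoreMemLp D 𝒟 P₁ P₂) {u g₁ g₂ φ : ℝ × ℝ → ℂ} (hφ : φ ∈ 𝒟)
    (h : u =ᵐ[volume.restrict D] φ) (h₁ : g₁ =ᵐ[volume.restrict D] P₁ φ)
    (h₂ : g₂ =ᵐ[volume.restrict D] P₂ φ) : InFormClosure D 𝒟 P₁ P₂ u g₁ g₂ := by
  obtain ⟨m, m₁, m₂⟩ := hm φ hφ
  have z : ∀ {a b : ℝ × ℝ → ℂ} {ε : ℝ≥0∞}, a =ᵐ[volume.restrict D] b → 0 < ε →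
      eLpNorm (a - b) 2 (volume.restrict D) < ε := by
    intro a b ε hab hε
    have : a - b =ᵐ[volume.restrict D] 0 := by
      filter_upwards [hab] with p hp
      simp [hp]
    rw [eLpNorm_congr_ae this]
    simpa using hε
  exact ⟨m.ae_eq h.symm, m₁.ae_eq h₁.symm, m₂.ae_eq h₂.symm,
    fun ε hε => ⟨φ, hφ, z h hε, z h₁ hε, z h₂ hε⟩⟩

theorem InFormClosure.congr_ae {u g₁ g₂ v h₁ h₂ : ℝ × ℝ → ℂ}
    (H : InFormClosure D 𝒟 P₁ P₂ u g₁ g₂) (e : u =ᵐ[volume.restrict D] v)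
    (e₁ : g₁ =ᵐ[volume.restrict D] h₁) (e₂ : g₂ =ᵐ[volume.restrict D] h₂) :
    InFormClosure D 𝒟 P₁ P₂ v h₁ h₂ := by
  obtain ⟨m, m₁, m₂, H⟩ := H
  refine ⟨m.ae_eq e, m₁.ae_eq e₁, m₂.ae_eq e₂, fun ε hε => ?_⟩
  obtain ⟨φ, hφ, a, a₁, a₂⟩ := H ε hε
  refine ⟨φ, hφ, ?_, ?_, ?_⟩
  · rwa [← eLpNorm_congr_ae (e.sub (Filter.EventuallyEq.refl _ φ))]
  · rwa [← eLpNorm_congr_ae (e₁.sub (Filter.EventuallyEq.refl _ (P₁ φ)))]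
  · rwa [← eLpNorm_congr_ae (e₂.sub (Filter.EventuallyEq.refl _ (P₂ φ)))]

/-- The form closure contains the limits of sequences of its elements. -/
theorem inFormClosure_of_forall {u g₁ g₂ : ℝ × ℝ → ℂ} (hm : CoreMemLp D 𝒟 P₁ P₂)
    (m : MemLp u 2 (volume.restrict D)) (m₁ : MemLp g₁ 2 (volume.restrict D))
    (m₂ : MemLp g₂ 2 (volume.restrict D))
    (H : ∀ ε : ℝ≥0∞, 0 < ε → ∃ v h₁ h₂, InFormClosure D 𝒟 P₁ P₂ v h₁ h₂ ∧
      eLpNorm (u - v) 2 (volume.restrict D) < ε ∧ eLpNorm (g₁ - h₁) 2 (volume.restrict D) < ε ∧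
      eLpNorm (g₂ - h₂) 2 (volume.restrict D) < ε) : InFormClosure D 𝒟 P₁ P₂ u g₁ g₂ := by
  refine ⟨m, m₁, m₂, fun ε hε => ?_⟩
  have hε2 : 0 < ε / 2 := ENNReal.half_pos hε.ne'
  obtain ⟨v, h₁, h₂, ⟨n, n₁, n₂, K⟩, b, b₁, b₂⟩ := H (ε / 2) hε2
  obtain ⟨φ, hφ, a, a₁, a₂⟩ := K (ε / 2) hε2
  obtain ⟨k, k₁, k₂⟩ := hm φ hφ
  have t : ∀ {a b c : ℝ × ℝ → ℂ}, MemLp a 2 (volume.restrict D) → MemLp b 2 (volume.restrict D) →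
      MemLp c 2 (volume.restrict D) → eLpNorm (a - b) 2 (volume.restrict D) < ε / 2 →
      eLpNorm (b - c) 2 (volume.restrict D) < ε / 2 →
      eLpNorm (a - c) 2 (volume.restrict D) < ε := by
    intro a b c ha hb hc h h'
    rw [← sub_add_sub_cancel a b c]
    refine (eLpNorm_add_le (ha.sub hb).1 (hb.sub hc).1 (by norm_num)).trans_lt ?_
    rw [← ENNReal.add_halves ε]
    exact ENNReal.add_lt_add h h'
  exact ⟨φ, hφ, t m n k b a, t m₁ n₁ k₁ b₁ a₁, t m₂ n₂ k₂ b₂ a₂⟩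

/-- The weak equation extends from the core to the form closure. -/
theorem weak_equation_of_inFormClosure (hm : CoreMemLp D 𝒟 P₁ P₂) {f g₁ g₂ w h₁ h₂ : ℝ × ℝ → ℂ}
    (mf : MemLp f 2 (volume.restrict D)) (m₁ : MemLp g₁ 2 (volume.restrict D))
    (m₂ : MemLp g₂ 2 (volume.restrict D))
    (H : ∀ φ ∈ 𝒟, ∫ p in D, (g₁ p * conj (P₁ φ p) + g₂ p * conj (P₂ φ p))
      = ∫ p in D, f p * conj (φ p))
    (hw : InFormClosure D 𝒟 P₁ P₂ w h₁ h₂) :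
    ∫ p in D, (g₁ p * conj (h₁ p) + g₂ p * conj (h₂ p)) = ∫ p in D, f p * conj (w p) := by
  obtain ⟨n, n₁, n₂, K⟩ := hw
  rw [← sub_eq_zero, ← enorm_eq_zero]
  set C := eLpNorm g₁ 2 (volume.restrict D) + eLpNorm g₂ 2 (volume.restrict D)
    + eLpNorm f 2 (volume.restrict D) with hC
  have hCt : C ≠ ⊤ := by
    simp [hC, m₁.2.ne, m₂.2.ne, mf.2.ne]
  -- Replacing `(w, h₁, h₂)` by an `ε`-close element of the core costs at most `C * ε`.
  have key : ∀ ε : ℝ≥0∞, 0 < ε → ‖(∫ p in D, (g₁ p * conj (h₁ p) + g₂ p * conj (h₂ p)))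
      - ∫ p in D, f p * conj (w p)‖ₑ ≤ C * ε := by
    intro ε hε
    obtain ⟨φ, hφ, a, a₁, a₂⟩ := K ε hε
    obtain ⟨k, k₁, k₂⟩ := hm φ hφ
    have E : (∫ p in D, (g₁ p * conj (h₁ p) + g₂ p * conj (h₂ p)))
        - ∫ p in D, f p * conj (w p)
        = (∫ p in D, g₁ p * conj ((h₁ - P₁ φ) p)) + (∫ p in D, g₂ p * conj ((h₂ - P₂ φ) p))
          - ∫ p in D, f p * conj ((w - φ) p) := by
      have H' := H φ hφ
      simp only [Pi.sub_apply, map_sub, mul_sub]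
      rw [integral_add (m₁.integrable_mul_conj k₁) (m₂.integrable_mul_conj k₂)] at H'
      rw [integral_add (m₁.integrable_mul_conj n₁) (m₂.integrable_mul_conj n₂),
        integral_sub (m₁.integrable_mul_conj n₁) (m₁.integrable_mul_conj k₁),
        integral_sub (m₂.integrable_mul_conj n₂) (m₂.integrable_mul_conj k₂),
        integral_sub (mf.integrable_mul_conj n) (mf.integrable_mul_conj k), ← H']
      ring
    rw [E, hC, add_mul, add_mul]
    refine enorm_sub_le.trans (add_le_add ((enorm_add_le _ _).trans (add_le_add ?_ ?_)) ?_)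
    · exact (norm_integral_mul_conj_le m₁ (n₁.sub k₁)).trans (by gcongr)
    · exact (norm_integral_mul_conj_le m₂ (n₂.sub k₂)).trans (by gcongr)
    · exact (norm_integral_mul_conj_le mf (n.sub k)).trans (by gcongr)
  by_contra hne
  obtain ⟨ε, hε, hlt⟩ := ENNReal.exists_pos_mul_lt hCt hne
  exact absurd (key ε hε) (not_le.2 (by rwa [mul_comm]))

variable {S₀ S₁ S₂ T₀ T₁ T₂ : (ℝ × ℝ → ℂ) →ₗ[ℂ] (ℝ × ℝ → ℂ)}

/-- An intertwining pair carries eigenfunctions to eigenfunctions: if bounded maps `Sᵢ` and their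
adjoints `Tᵢ` carry each form core, jets included, into the closure of the other form, then the
image of an eigenfunction satisfies the eigenvalue equation. -/
theorem IsFormOperator.transfer (h₀ : L2Pair D D' S₀ T₀) (h₁ : L2Pair D D' S₁ T₁)
    (h₂ : L2Pair D D' S₂ T₂) (hm : CoreMemLp D 𝒟 P₁ P₂) (hm' : CoreMemLp D' 𝒟' P₁' P₂')
    (hS : ∀ φ ∈ 𝒟, InFormClosure D' 𝒟' P₁' P₂' (S₀ φ) (S₁ (P₁ φ)) (S₂ (P₂ φ)))
    (hT : ∀ ψ ∈ 𝒟', InFormClosure D 𝒟 P₁ P₂ (T₀ ψ) (T₁ (P₁' ψ)) (T₂ (P₂' ψ)))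
    {u : ℝ × ℝ → ℂ} {z : ℂ} (hu : IsFormOperator D 𝒟 P₁ P₂ u (fun p => z * u p)) :
    IsFormOperator D' 𝒟' P₁' P₂' (S₀ u) (fun p => z * S₀ u p) := by
  obtain ⟨mf, g₁, g₂, hcl, heq⟩ := hu
  obtain ⟨m, m₁, m₂, hc⟩ := hcl
  have e : S₀ (fun p => z * u p) = fun p => z * S₀ u p := by
    rw [show (fun p => z * u p) = z • u from rfl, map_smul]
    rfl
  refine ⟨by rw [← e]; exact h₀.memLp _ mf, S₁ g₁, S₂ g₂, ?_, fun ψ hψ => ?_⟩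
  · obtain ⟨C₀, hC₀, b₀⟩ := h₀.bound
    obtain ⟨C₁, hC₁, b₁⟩ := h₁.bound
    obtain ⟨C₂, hC₂, b₂⟩ := h₂.bound
    refine inFormClosure_of_forall hm' (h₀.memLp _ m) (h₁.memLp _ m₁) (h₂.memLp _ m₂)
      fun ε hε => ?_
    obtain ⟨δ, hδ, hlt⟩ := ENNReal.exists_pos_mul_lt (a := C₀ + C₁ + C₂) (by simp [*]) hε.ne'
    obtain ⟨φ, hφ, a, a₁, a₂⟩ := hc δ hδ
    obtain ⟨k, k₁, k₂⟩ := hm φ hφ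
    refine ⟨_, _, _, hS φ hφ, ?_, ?_, ?_⟩
    · rw [← map_sub]
      refine ((b₀ _ (m.sub k)).trans ?_).trans_lt hlt
      rw [mul_comm δ]
      exact mul_le_mul' (by rw [add_assoc]; exact le_self_add) a.le
    · rw [← map_sub]
      refine ((b₁ _ (m₁.sub k₁)).trans ?_).trans_lt hlt
      rw [mul_comm δ]
      exact mul_le_mul' (le_add_self.trans le_self_add) a₁.le
    · rw [← map_sub]
      refine ((b₂ _ (m₂.sub k₂)).trans ?_).trans_lt hlt
      rw [mul_comm δ]
      exact mul_le_mul' le_add_self a₂.le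
  · obtain ⟨k, k₁, k₂⟩ := hm' ψ hψ
    have W := weak_equation_of_inFormClosure hm mf m₁ m₂ heq (hT ψ hψ)
    rw [← e, h₀.adj _ _ mf k, ← W,
      integral_add ((h₁.memLp _ m₁).integrable_mul_conj k₁)
        ((h₂.memLp _ m₂).integrable_mul_conj k₂),
      integral_add (m₁.integrable_mul_conj (h₁.memLp' _ k₁))
        (m₂.integrable_mul_conj (h₂.memLp' _ k₂)), h₁.adj _ _ m₁ k₁, h₂.adj _ _ m₂ k₂]

/-- The two components of the gradient play symmetric roles. -/
theorem formEigenvalues_swap : formEigenvalues D 𝒟 P₁ P₂ ⊆ formEigenvalues D 𝒟 P₂ P₁ := by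
  rintro z ⟨u, hu, mf, g₁, g₂, ⟨m, m₁, m₂, hc⟩, heq⟩
  refine ⟨u, hu, mf, g₂, g₁, ⟨m, m₂, m₁, fun ε hε => ?_⟩, fun φ hφ => ?_⟩
  · obtain ⟨φ, hφ, a, a₁, a₂⟩ := hc ε hε
    exact ⟨φ, hφ, a, a₂, a₁⟩
  · rw [← heq φ hφ]
    simp only [add_comm]

end Forms

/-! ### The phases `e^{iθ}` and `e^{iθ/2}` -/

/-- The phase `e^{iθ}`, where `θ` is the principal argument; on the punctured plane it is smooth. -/
noncomputable def phase (p : ℝ × ℝ) : ℂ :=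
  Complex.exp (((Complex.equivRealProdCLM.symm p).arg : ℝ) * Complex.I)

/-- The phase `e^{iθ/2}`, where `θ` is the principal argument.  It jumps by the factor `-1` across
the half-line `{x ≤ 0, y = 0}`. -/
noncomputable def halfPhase (p : ℝ × ℝ) : ℂ :=
  Complex.exp (((Complex.equivRealProdCLM.symm p).arg / 2 : ℝ) * Complex.I)

/-- The plane cut along the half-line `{x ≤ 0, y = 0}`. -/
def cutPlane : Set (ℝ × ℝ) := {p | 0 < p.1 ∨ p.2 ≠ 0}

theorem mem_cutPlane_iff {p : ℝ × ℝ} :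
    p ∈ cutPlane ↔ Complex.equivRealProdCLM.symm p ∈ Complex.slitPlane := by
  simp [cutPlane, Complex.mem_slitPlane_iff]

theorem mem_cutPlane_or_neg {p : ℝ × ℝ} (hp : p ≠ 0) : p ∈ cutPlane ∨ -p ∈ cutPlane := by
  by_contra! h
  simp only [cutPlane, mem_ofPred_eq, not_or, not_lt, ne_eq, not_not, Prod.fst_neg] at h
  exact hp (Prod.ext (le_antisymm h.1.1 (neg_nonpos.1 h.2.1)) h.1.2)

theorem ne_zero_of_mem_cutPlane {p : ℝ × ℝ} (hp : p ∈ cutPlane) : p ≠ 0 := by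
  rintro rfl
  simp [cutPlane] at hp

theorem norm_phase (p : ℝ × ℝ) : ‖phase p‖ = 1 := Complex.norm_exp_ofReal_mul_I _

theorem norm_halfPhase (p : ℝ × ℝ) : ‖halfPhase p‖ = 1 := Complex.norm_exp_ofReal_mul_I _

theorem measurable_phase : Measurable phase := by
  unfold phase
  have := Complex.measurable_arg.comp Complex.equivRealProdCLM.symm.continuous.measurable
  exact Complex.measurable_exp.comp ((Complex.measurable_ofReal.comp this).mul_const _)

theorem measurable_halfPhase : Measurable halfPhase := by
  unfold halfPhase
  have := (Complex.measurable_arg.comp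
    Complex.equivRealProdCLM.symm.continuous.measurable).div_const 2
  exact Complex.measurable_exp.comp ((Complex.measurable_ofReal.comp this).mul_const _)

theorem halfPhase_mul_self (p : ℝ × ℝ) : halfPhase p * halfPhase p = phase p := by
  rw [halfPhase, phase, ← Complex.exp_add]
  congr 1
  push_cast
  ring

theorem conj_halfPhase_mul_self (p : ℝ × ℝ) : conj (halfPhase p) * halfPhase p = 1 := by
  rw [mul_comm, Complex.mul_conj, Complex.normSq_eq_norm_sq, norm_halfPhase]
  simp

theorem halfPhase_mul_conj_self (p : ℝ × ℝ) : halfPhase p * conj (halfPhase p) = 1 := by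
  rw [mul_comm, conj_halfPhase_mul_self]

theorem conj_halfPhase_mul_phase (p : ℝ × ℝ) : conj (halfPhase p) * phase p = halfPhase p := by
  rw [← halfPhase_mul_self, ← mul_assoc, conj_halfPhase_mul_self, one_mul]

theorem phase_eq_div {p : ℝ × ℝ} (hp : p ≠ 0) :
    phase p = Complex.equivRealProdCLM.symm p / ‖Complex.equivRealProdCLM.symm p‖ := by
  have h : Complex.equivRealProdCLM.symm p ≠ 0 := by simpa using hp
  rw [eq_div_iff (by simpa using hp), mul_comm, phase, Complex.norm_mul_exp_arg_mul_I]

theorem phase_neg {p : ℝ × ℝ} (hp : p ≠ 0) : phase (-p) = -phase p := by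
  rw [phase_eq_div hp, phase_eq_div (neg_ne_zero.2 hp), map_neg, norm_neg, neg_div]

theorem phase_of_neg_axis {p : ℝ × ℝ} (h1 : p.1 < 0) (h2 : p.2 = 0) : phase p = -1 := by
  have : Complex.equivRealProdCLM.symm p = (p.1 : ℂ) := by
    apply Complex.ext <;> simp [h2]
  rw [phase, this, Complex.arg_ofReal_of_neg h1, Complex.exp_pi_mul_I]

theorem halfPhase_reflect {p : ℝ × ℝ} (hp : p ∈ cutPlane) :
    halfPhase (p.1, -p.2) = conj (halfPhase p) := by
  have e : Complex.equivRealProdCLM.symm (p.1, -p.2)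
      = conj (Complex.equivRealProdCLM.symm p) := by
    apply Complex.ext <;> simp
  have ha := Complex.mem_slitPlane_iff_arg.1 (mem_cutPlane_iff.1 hp)
  rw [halfPhase, e, Complex.arg_conj, if_neg ha.1, halfPhase, ← Complex.exp_conj]
  congr 1
  simp only [map_mul, Complex.conj_ofReal, Complex.conj_I]
  push_cast
  ring

theorem fderiv_halfPhase {p : ℝ × ℝ} (hp : p ∈ cutPlane) :
    DifferentiableAt ℝ halfPhase p ∧ ∀ v, fderiv ℝ halfPhase p v
      = Complex.I * (potentialX p * v.1 + potentialY p * v.2) * halfPhase p := by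
  have hs := mem_cutPlane_iff.1 hp
  have h1 : HasFDerivAt (fun p : ℝ × ℝ => Complex.log (Complex.equivRealProdCLM.symm p)) _ p :=
    ((Complex.hasDerivAt_log hs).hasFDerivAt.restrictScalars ℝ).comp p
      Complex.equivRealProdCLM.symm.hasFDerivAt
  have h2 : HasFDerivAt (fun p : ℝ × ℝ => (Complex.equivRealProdCLM.symm p).arg) _ p :=
    (Complex.imCLM.hasFDerivAt.comp p h1).congr_of_eventuallyEq
      (.of_forall fun q => (Complex.log_im _).symm)
  have h3 : HasFDerivAt halfPhase _ p :=
    ((Complex.ofRealCLM.hasFDerivAt.comp p (h2.mul_const (1 / 2 : ℝ))).mul_const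
      Complex.I).cexp.congr_of_eventuallyEq (.of_forall fun q => by
        simp [halfPhase, div_eq_mul_inv])
  refine ⟨h3.differentiableAt, fun v => ?_⟩
  rw [h3.fderiv]
  have hv : (v.1 * potentialX p + v.2 * potentialY p : ℝ)
      = ((Complex.equivRealProdCLM.symm p)⁻¹ * Complex.equivRealProdCLM.symm v).im * (1 / 2) := by
    simp only [potentialX, potentialY, Complex.mul_im, Complex.inv_re, Complex.inv_im,
      Complex.normSq_apply]
    simp
    ring
  have hv' := congrArg (fun t : ℝ => (t : ℂ)) hv
  push_cast at hv'
  simp [halfPhase, div_eq_mul_inv] at hv' ⊢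
  linear_combination (-Complex.I *
    Complex.exp ((Complex.equivRealProdCLM.symm p).arg * 2⁻¹ * Complex.I)) * hv'

theorem contDiffAt_halfPhase {p : ℝ × ℝ} (hp : p ∈ cutPlane) : ContDiffAt ℝ ∞ halfPhase p := by
  have hs := mem_cutPlane_iff.1 hp
  have h1 : ContDiffAt ℝ ∞ (fun p : ℝ × ℝ => Complex.log (Complex.equivRealProdCLM.symm p)) p :=
    ((Complex.contDiffAt_log hs).restrict_scalars ℝ).comp p
      Complex.equivRealProdCLM.symm.contDiff.contDiffAt
  have h2 : ContDiffAt ℝ ∞ (fun p : ℝ × ℝ => (Complex.equivRealProdCLM.symm p).arg) p :=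
    (Complex.imCLM.contDiff.contDiffAt.comp p h1).congr_of_eventuallyEq
      (.of_forall fun q => (Complex.log_im _).symm)
  exact ((Complex.ofRealCLM.contDiff.contDiffAt.comp p (h2.div_const 2)).mul
    contDiffAt_const).cexp

theorem phase_eventuallyEq_neg {p : ℝ × ℝ} (hp : p ≠ 0) :
    phase =ᶠ[nhds p] fun q => -phase (-q) := by
  filter_upwards [isOpen_ne.mem_nhds hp] with q hq
  rw [phase_neg hq, neg_neg]

theorem contDiffAt_phase {p : ℝ × ℝ} (hp : p ≠ 0) : ContDiffAt ℝ ∞ phase p := by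
  have key : ∀ {p}, p ∈ cutPlane → ContDiffAt ℝ ∞ phase p := fun {p} h => by
    have := (contDiffAt_halfPhase h).mul (contDiffAt_halfPhase h)
    exact this.congr_of_eventuallyEq (.of_forall fun q => (halfPhase_mul_self q).symm)
  rcases mem_cutPlane_or_neg hp with h | h
  · exact key h
  · exact (((key h).comp p contDiffAt_id.neg).neg).congr_of_eventuallyEq
      (phase_eventuallyEq_neg hp)

theorem fderiv_phase {p : ℝ × ℝ} (hp : p ≠ 0) (v : ℝ × ℝ) : fderiv ℝ phase p v
      = 2 * Complex.I * (potentialX p * v.1 + potentialY p * v.2) * phase p := by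
  have key : ∀ {p}, p ∈ cutPlane → ∀ v, fderiv ℝ phase p v
      = 2 * Complex.I * (potentialX p * v.1 + potentialY p * v.2) * phase p := fun {p} h v => by
    obtain ⟨hd, hv⟩ := fderiv_halfPhase h
    rw [show phase = fun q => halfPhase q * halfPhase q from
      funext fun q => (halfPhase_mul_self q).symm, fderiv_fun_mul hd hd]
    simp [hv]
    ring
  rcases mem_cutPlane_or_neg hp with h | h
  · exact key h v
  · have hd : DifferentiableAt ℝ phase (-p) :=
      (contDiffAt_phase (neg_ne_zero.2 hp)).differentiableAt (by simp)
    have h1 : HasFDerivAt (fun q => -phase (-q)) _ p :=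
      (hd.hasFDerivAt.comp p (hasFDerivAt_id p).neg).neg
    rw [(phase_eventuallyEq_neg hp).fderiv_eq, h1.fderiv]
    have hX : potentialX (-p) = -potentialX p := by simp [potentialX, neg_div]
    have hY : potentialY (-p) = -potentialY p := by simp [potentialY, neg_div]
    simp [key h, phase_neg hp, hX, hY]
    ring

/-! ### Gauge transformations -/

/-- Multiplication by `e^{iθ/2}` gauges the potential away on the cut plane. -/
theorem magnetic_halfPhase_mul {p : ℝ × ℝ} (hp : p ∈ cutPlane) {w : ℝ × ℝ → ℂ}
    (hw : DifferentiableAt ℝ w p) :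
    magneticX (fun q => halfPhase q * w q) p = halfPhase p * (-Complex.I * partialX w p) ∧
    magneticY (fun q => halfPhase q * w q) p = halfPhase p * (-Complex.I * partialY w p) := by
  obtain ⟨hd, hv⟩ := fderiv_halfPhase hp
  constructor
  · rw [magneticX, partialX, fderiv_fun_mul hd hw, partialX]
    simp [hv]
    linear_combination (-halfPhase p * w p * potentialX p) * Complex.I_sq
  · rw [magneticY, partialY, fderiv_fun_mul hd hw, partialY]
    simp [hv]
    linear_combination (-halfPhase p * w p * potentialY p) * Complex.I_sq

/-- On the cut plane the gradient of `e^{-iθ/2} φ` is, up to the factor `i e^{-iθ/2}`, the magnetic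
gradient of `φ`. -/
theorem partial_conj_halfPhase_mul {p : ℝ × ℝ} (hp : p ∈ cutPlane) {φ : ℝ × ℝ → ℂ}
    (hφ : DifferentiableAt ℝ φ p) :
    partialX (fun q => conj (halfPhase q) * φ q) p
      = Complex.I * (conj (halfPhase p) * magneticX φ p) ∧
    partialY (fun q => conj (halfPhase q) * φ q) p
      = Complex.I * (conj (halfPhase p) * magneticY φ p) := by
  have hd : DifferentiableAt ℝ (fun q => conj (halfPhase q)) p :=
    Complex.conjCLE.differentiableAt.comp p (fderiv_halfPhase hp).1
  have e : φ = fun q => halfPhase q * (conj (halfPhase q) * φ q) := funext fun q => by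
    rw [← mul_assoc, halfPhase_mul_conj_self, one_mul]
  have h := magnetic_halfPhase_mul hp (hd.mul hφ)
  have h1 : magneticX φ p = _ := (congrArg (fun f => magneticX f p) e).trans h.1
  have h2 : magneticY φ p = _ := (congrArg (fun f => magneticY f p) e).trans h.2
  constructor
  · rw [h1, ← mul_assoc (conj _), conj_halfPhase_mul_self, one_mul, ← mul_assoc]
    simp
    rfl
  · rw [h2, ← mul_assoc (conj _), conj_halfPhase_mul_self, one_mul, ← mul_assoc]
    simp
    rfl

/-- A reflection of the plane reverses the sign of the flux, and multiplication by `e^{iθ}` restores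
it: the magnetic gradient of `e^{iθ} φ ∘ f` is `e^{iθ}` times the reflected magnetic gradient
of `φ`. -/
theorem magnetic_phase_mul_comp {f : (ℝ × ℝ) ≃L[ℝ] (ℝ × ℝ)} {α β : ℝ}
    (hf : ∀ p, f p = (α * p.1 + β * p.2, β * p.1 - α * p.2)) (hαβ : α ^ 2 + β ^ 2 = 1)
    {p : ℝ × ℝ} (hp : p ≠ 0) {φ : ℝ × ℝ → ℂ} (hφ : DifferentiableAt ℝ φ (f p)) :
    magneticX (fun q => phase q * φ (f q)) p
      = phase p * (α * magneticX φ (f p) + β * magneticY φ (f p)) ∧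
    magneticY (fun q => phase q * φ (f q)) p
      = phase p * (β * magneticX φ (f p) - α * magneticY φ (f p)) := by
  have hd : DifferentiableAt ℝ phase p := (contDiffAt_phase hp).differentiableAt (by simp)
  have hc : HasFDerivAt (fun q => φ (f q)) _ p := hφ.hasFDerivAt.comp p f.hasFDerivAt
  have hn : (f p).1 ^ 2 + (f p).2 ^ 2 = p.1 ^ 2 + p.2 ^ 2 := by
    rw [hf]
    linear_combination (p.1 ^ 2 + p.2 ^ 2) * hαβ
  have hX : α * potentialX (f p) + β * potentialY (f p) = -potentialX p := by
    simp only [potentialX, potentialY, hn]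
    rw [hf]
    linear_combination (p.2 / (p.1 ^ 2 + p.2 ^ 2) / 2) * hαβ
  have hY : β * potentialX (f p) - α * potentialY (f p) = -potentialY p := by
    simp only [potentialX, potentialY, hn]
    rw [hf]
    linear_combination (-p.1 / (p.1 ^ 2 + p.2 ^ 2) / 2) * hαβ
  have hX' := congrArg (fun t : ℝ => (t : ℂ)) hX
  have hY' := congrArg (fun t : ℝ => (t : ℂ)) hY
  push_cast at hX' hY'
  have lin : ∀ s t : ℝ, fderiv ℝ φ (f p) (s, t)
      = s * fderiv ℝ φ (f p) (1, 0) + t * fderiv ℝ φ (f p) (0, 1) := fun s t => by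
    have : ((s, t) : ℝ × ℝ) = s • (1, 0) + t • (0, 1) := by ext <;> simp
    rw [this, map_add, map_smul, map_smul]
    simp
  constructor
  · simp only [magneticX, magneticY, partialX, partialY]
    rw [fderiv_fun_mul hd hc.differentiableAt, hc.fderiv]
    simp [fderiv_phase hp, hf (1, 0), lin α β]
    linear_combination (phase p * φ (f p)) * hX'
      - (2 * phase p * φ (f p) * potentialX p) * Complex.I_sq
  · simp only [magneticX, magneticY, partialX, partialY]
    rw [fderiv_fun_mul hd hc.differentiableAt, hc.fderiv]
    simp [fderiv_phase hp, hf (0, 1), lin β (-α)]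
    linear_combination (phase p * φ (f p)) * hY'
      - (2 * phase p * φ (f p) * potentialY p) * Complex.I_sq

theorem partial_comp {f : (ℝ × ℝ) ≃L[ℝ] (ℝ × ℝ)} {α β : ℝ}
    (hf : ∀ p, f p = (α * p.1 + β * p.2, β * p.1 - α * p.2))
    {p : ℝ × ℝ} {φ : ℝ × ℝ → ℂ} (hφ : DifferentiableAt ℝ φ (f p)) :
    partialX (fun q => φ (f q)) p = α * partialX φ (f p) + β * partialY φ (f p) ∧
    partialY (fun q => φ (f q)) p = β * partialX φ (f p) - α * partialY φ (f p) := by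
  have hc : HasFDerivAt (fun q => φ (f q)) _ p := hφ.hasFDerivAt.comp p f.hasFDerivAt
  have lin : ∀ s t : ℝ, fderiv ℝ φ (f p) (s, t)
      = s * fderiv ℝ φ (f p) (1, 0) + t * fderiv ℝ φ (f p) (0, 1) := fun s t => by
    have : ((s, t) : ℝ × ℝ) = s • (1, 0) + t • (0, 1) := by ext <;> simp
    rw [this, map_add, map_smul, map_smul]
    simp
  constructor
  · simp only [partialX, partialY]
    rw [hc.fderiv]
    simp [hf (1, 0), lin α β]
  · simp only [partialX, partialY]
    rw [hc.fderiv]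
    simp [hf (0, 1), lin β (-α)]
    ring

/-! ### Test functions -/

theorem mul_mem_testFunctions {U : Set (ℝ × ℝ)} {c φ : ℝ × ℝ → ℂ}
    (hc : ∀ p ∈ U, ContDiffAt ℝ ∞ c p) (hφ : φ ∈ testFunctions U) :
    (fun p => c p * φ p) ∈ testFunctions U := by
  obtain ⟨hs, hcomp, hsub⟩ := hφ
  have hsupp : tsupport (fun p => c p * φ p) ⊆ tsupport φ :=
    closure_mono fun p hp h0 => hp (by simp [h0])
  refine ⟨contDiff_iff_contDiffAt.2 fun p => ?_, hcomp.mul_left, hsupp.trans hsub⟩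
  by_cases hp : p ∈ tsupport φ
  · exact (hc p (hsub hp)).mul hs.contDiffAt
  · exact contDiffAt_const.congr_of_eventuallyEq
      (notMem_tsupport_iff_eventuallyEq.1 fun h => hp (hsupp h))

theorem add_mem_testFunctions {U : Set (ℝ × ℝ)} {φ ψ : ℝ × ℝ → ℂ}
    (hφ : φ ∈ testFunctions U) (hψ : ψ ∈ testFunctions U) :
    (fun p => φ p + ψ p) ∈ testFunctions U :=
  ⟨hφ.1.add hψ.1, hφ.2.1.add hψ.2.1, (tsupport_add φ ψ).trans (union_subset hφ.2.2 hψ.2.2)⟩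

theorem comp_mem_testFunctions {U : Set (ℝ × ℝ)} (f : (ℝ × ℝ) ≃L[ℝ] (ℝ × ℝ)) {φ : ℝ × ℝ → ℂ}
    (hφ : φ ∈ testFunctions U) : (fun p => φ (f p)) ∈ testFunctions (f ⁻¹' U) :=
  ⟨hφ.1.comp f.contDiff, hφ.2.1.comp_homeomorph f.toHomeomorph,
    (tsupport_comp_subset_preimage φ f.continuous).trans (preimage_mono hφ.2.2)⟩

theorem memLp_of_mem_testFunctions {U D : Set (ℝ × ℝ)} {φ : ℝ × ℝ → ℂ}
    (hφ : φ ∈ testFunctions U) : MemLp φ 2 (volume.restrict D) :=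
  (hφ.1.continuous.memLp_of_hasCompactSupport hφ.2.1).restrict D

theorem magneticX_mem_testFunctions {Ω : Set (ℝ × ℝ)} {φ : ℝ × ℝ → ℂ}
    (hφ : φ ∈ testFunctions (Ω \ {0})) : magneticX φ ∈ testFunctions (Ω \ {0}) :=
  magneticDeriv_mem_testFunctions (1, 0) (fun _ hp => contDiffAt_potentialX hp.2) hφ

theorem magneticY_mem_testFunctions {Ω : Set (ℝ × ℝ)} {φ : ℝ × ℝ → ℂ}
    (hφ : φ ∈ testFunctions (Ω \ {0})) : magneticY φ ∈ testFunctions (Ω \ {0}) :=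
  magneticDeriv_mem_testFunctions (0, 1) (fun _ hp => contDiffAt_potentialY hp.2) hφ

theorem coreMemLp_magnetic (Ω D : Set (ℝ × ℝ)) :
    CoreMemLp D (testFunctions (Ω \ {0})) magneticX magneticY := fun _ hφ =>
  ⟨memLp_of_mem_testFunctions hφ, memLp_of_mem_testFunctions (magneticX_mem_testFunctions hφ),
    memLp_of_mem_testFunctions (magneticY_mem_testFunctions hφ)⟩

theorem continuous_partialX {φ : ℝ × ℝ → ℂ} (hφ : ContDiff ℝ ∞ φ) : Continuous (partialX φ) :=
  (hφ.continuous_fderiv (by simp)).clm_apply continuous_const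

theorem continuous_partialY {φ : ℝ × ℝ → ℂ} (hφ : ContDiff ℝ ∞ φ) : Continuous (partialY φ) :=
  (hφ.continuous_fderiv (by simp)).clm_apply continuous_const

theorem coreMemLp_mixed (D D' N : Set (ℝ × ℝ)) :
    CoreMemLp D (mixedTestFunctions D' N) partialX partialY := fun _ hφ =>
  ⟨(hφ.1.continuous.memLp_of_hasCompactSupport hφ.2.1).restrict D,
    ((continuous_partialX hφ.1).memLp_of_hasCompactSupport (hφ.2.1.fderiv_apply ℝ _)).restrict D,
    ((continuous_partialY hφ.1).memLp_of_hasCompactSupport (hφ.2.1.fderiv_apply ℝ _)).restrict D⟩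

theorem comp_mem_mixedTestFunctions {D N : Set (ℝ × ℝ)} (f : (ℝ × ℝ) ≃L[ℝ] (ℝ × ℝ))
    {φ : ℝ × ℝ → ℂ} (hφ : φ ∈ mixedTestFunctions D N) :
    (fun p => φ (f p)) ∈ mixedTestFunctions (f ⁻¹' D) (f ⁻¹' N) := by
  refine ⟨hφ.1.comp f.contDiff, hφ.2.1.comp_homeomorph f.toHomeomorph, ?_⟩
  have h1 : frontier (f ⁻¹' D) = f ⁻¹' frontier D := (f.toHomeomorph.preimage_frontier D).symm
  have h2 : closure (f ⁻¹' frontier D \ f ⁻¹' N) = f ⁻¹' closure (frontier D \ N) := by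
    rw [← preimage_sdiff]
    exact (f.toHomeomorph.preimage_closure _).symm
  rw [h1, h2]
  exact (hφ.2.2.preimage f).mono_left (tsupport_comp_subset_preimage φ f.continuous)

/-! ### Symmetries -/

section Symmetry

variable {D : Set (ℝ × ℝ)} {𝒟 𝒟' : Set (ℝ × ℝ → ℂ)}
  {P₁ P₂ P₁' P₂' : (ℝ × ℝ → ℂ) → (ℝ × ℝ → ℂ)}

/-- A unimodular multiplier composed with a measure preserving involution transports
eigenfunctions, provided that it maps one form core onto the other and transforms the components
of the gradient by signs `s₁` and `s₂`. -/
theorem IsFormOperator.transfer_comp {f : (ℝ × ℝ) ≃L[ℝ] (ℝ × ℝ)} {c : ℝ × ℝ → ℂ} {s₁ s₂ : ℝ}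
    (hf : MeasurePreserving f volume volume) (hinv : Function.Involutive f)
    (hD : MeasurableSet D) (hc : Measurable c) (hc1 : ∀ p, ‖c p‖ = 1)
    (hs₁ : |s₁| = 1) (hs₂ : |s₂| = 1)
    (hm : CoreMemLp D 𝒟 P₁ P₂) (hm' : CoreMemLp (f ⁻¹' D) 𝒟' P₁' P₂')
    (hS : ∀ φ ∈ 𝒟, (fun p => c p * φ (f p)) ∈ 𝒟')
    (hT : ∀ ψ ∈ 𝒟', (fun p => conj (c (f p)) * ψ (f p)) ∈ 𝒟)
    (hP : ∀ φ ∈ 𝒟, ∀ p ∈ f ⁻¹' D,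
      P₁' (fun p => c p * φ (f p)) p = s₁ * (c p * P₁ φ (f p)) ∧
      P₂' (fun p => c p * φ (f p)) p = s₂ * (c p * P₂ φ (f p)))
    {u : ℝ × ℝ → ℂ} {z : ℂ} (hu : IsFormOperator D 𝒟 P₁ P₂ u (fun p => z * u p)) :
    IsFormOperator (f ⁻¹' D) 𝒟' P₁' P₂' (fun p => c p * u (f p))
      (fun p => z * (c p * u (f p))) := by
  have hD' : MeasurableSet (f ⁻¹' D) := f.continuous.measurable hD
  have hcc : ∀ p, conj (c p) * c p = 1 := fun p => by
    rw [mul_comm, Complex.mul_conj, Complex.normSq_eq_norm_sq, hc1]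
    simp
  have sq : ∀ {s : ℝ}, |s| = 1 → (s : ℂ) * s = 1 := fun {s} h => by
    rw [← Complex.ofReal_mul, ← abs_mul_abs_self, h]
    simp
  have pair : ∀ {s : ℝ}, |s| = 1 → L2Pair D (f ⁻¹' D) _ _ := fun {s} h =>
    (L2Pair.comp hf hinv hD).trans (L2Pair.mul (D := f ⁻¹' D) (c := fun p => s * c p)
      (hc.const_mul _) (fun p => by simp [hc1, h]))
  have p0 := (L2Pair.comp hf hinv hD).trans (L2Pair.mul (D := f ⁻¹' D) hc (fun p => (hc1 p).le))
  refine IsFormOperator.transfer p0 (pair hs₁) (pair hs₂) hm hm' (fun φ hφ => ?_)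
    (fun ψ hψ => ?_) hu
  · refine inFormClosure_of_ae_eq hm' (hS φ hφ) (.of_forall fun p => rfl) ?_ ?_
    · filter_upwards [ae_restrict_mem hD'] with p hp
      rw [(hP φ hφ p hp).1]
      simp [LinearMap.funLeft_apply, mul_assoc]
    · filter_upwards [ae_restrict_mem hD'] with p hp
      rw [(hP φ hφ p hp).2]
      simp [LinearMap.funLeft_apply, mul_assoc]
  · set χ : ℝ × ℝ → ℂ := fun p => conj (c (f p)) * ψ (f p) with hχ
    have e : ψ = fun p => c p * χ (f p) := funext fun p => by
      simp only [hχ, hinv p]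
      rw [← mul_assoc, mul_comm (c p), hcc, one_mul]
    refine inFormClosure_of_ae_eq hm (hT ψ hψ) (.of_forall fun p => ?_) ?_ ?_
    · simp [LinearMap.funLeft_apply]
    · filter_upwards [ae_restrict_mem hD] with p hp
      have h := (hP χ (hT ψ hψ) (f p) (by simpa [hinv p] using hp)).1
      rw [← e, hinv p] at h
      simp only [LinearMap.comp_apply, LinearMap.funLeft_apply, LinearMap.mulLeft_apply,
        Pi.mul_apply, Pi.star_apply, h, RCLike.star_def, map_mul, Complex.conj_ofReal]
      linear_combination (s₁ * s₁ * P₁ χ p) * hcc (f p) + P₁ χ p * sq hs₁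
    · filter_upwards [ae_restrict_mem hD] with p hp
      have h := (hP χ (hT ψ hψ) (f p) (by simpa [hinv p] using hp)).2
      rw [← e, hinv p] at h
      simp only [LinearMap.comp_apply, LinearMap.funLeft_apply, LinearMap.mulLeft_apply,
        Pi.mul_apply, Pi.star_apply, h, RCLike.star_def, map_mul, Complex.conj_ofReal]
      linear_combination (s₂ * s₂ * P₂ χ p) * hcc (f p) + P₂ χ p * sq hs₂

theorem not_ae_eq_zero_comp {f : (ℝ × ℝ) ≃L[ℝ] (ℝ × ℝ)} {c : ℝ × ℝ → ℂ}
    (hf : MeasurePreserving f volume volume) (hinv : Function.Involutive f)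
    (hD : MeasurableSet D) (hc1 : ∀ p, ‖c p‖ = 1) {u : ℝ × ℝ → ℂ}
    (hu : ¬ u =ᵐ[volume.restrict D] 0) :
    ¬ (fun p => c p * u (f p)) =ᵐ[volume.restrict (f ⁻¹' D)] 0 := by
  intro h
  apply hu
  have h2 : MeasurePreserving f (volume.restrict D) (volume.restrict (f ⁻¹' D)) := by
    have := hf.restrict_preimage (s := f ⁻¹' D) (f.continuous.measurable hD)
    rwa [← preimage_comp, hinv.comp_self, preimage_id] at this
  filter_upwards [h2.quasiMeasurePreserving.ae h] with p hp
  have hne : c (f p) ≠ 0 := fun h0 => by simpa [h0] using hc1 (f p)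
  simpa [hinv p, hne] using hp

end Symmetry

/-- The Aharonov–Bohm test functions are invariant under the gauged reflections. -/
theorem phase_mul_comp_mem_testFunctions {Ω : Set (ℝ × ℝ)} (f : (ℝ × ℝ) ≃L[ℝ] (ℝ × ℝ))
    {φ : ℝ × ℝ → ℂ} (hφ : φ ∈ testFunctions (Ω \ {0})) :
    (fun p => phase p * φ (f p)) ∈ testFunctions (f ⁻¹' Ω \ {0}) := by
  have e : f ⁻¹' (Ω \ {0}) = f ⁻¹' Ω \ {0} := by
    ext p
    simp
  exact e ▸ mul_mem_testFunctions (fun p hp => contDiffAt_phase (by simpa using hp.2))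
    (comp_mem_testFunctions f hφ)

theorem conj_phase_mul_comp_mem_testFunctions {Ω : Set (ℝ × ℝ)} {f : (ℝ × ℝ) ≃L[ℝ] (ℝ × ℝ)}
    (hinv : Function.Involutive f)
    {φ : ℝ × ℝ → ℂ} (hφ : φ ∈ testFunctions (f ⁻¹' Ω \ {0})) :
    (fun p => conj (phase (f p)) * φ (f p)) ∈ testFunctions (Ω \ {0}) := by
  have e : f ⁻¹' (f ⁻¹' Ω \ {0}) = Ω \ {0} := by
    ext p
    simp [hinv p]
  exact e ▸ comp_mem_testFunctions f (mul_mem_testFunctions (c := fun p => conj (phase p))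
    (fun p hp => Complex.conjCLE.contDiff.contDiffAt.comp p (contDiffAt_phase hp.2)) hφ)

/-- The reflection `(x, y) ↦ (s x, -s y)`, `s = ±1`, maps Aharonov–Bohm eigenfunctions on `Ω` to
Aharonov–Bohm eigenfunctions on the reflected domain. -/
theorem isFormOperator_magnetic_reflect {Ω : Set (ℝ × ℝ)} (hΩ : MeasurableSet Ω)
    {f : (ℝ × ℝ) ≃L[ℝ] (ℝ × ℝ)} {s : ℝ} (hs : |s| = 1) (hfs : ∀ p, f p = (s * p.1, -(s * p.2)))
    (hf : MeasurePreserving f volume volume) (hinv : Function.Involutive f)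
    {u : ℝ × ℝ → ℂ} {z : ℂ}
    (hu : IsFormOperator (Ω \ {0}) (testFunctions (Ω \ {0})) magneticX magneticY u
      (fun p => z * u p)) :
    IsFormOperator (f ⁻¹' Ω \ {0}) (testFunctions (f ⁻¹' Ω \ {0})) magneticX magneticY
      (fun p => phase p * u (f p)) (fun p => z * (phase p * u (f p))) := by
  have e : f ⁻¹' (Ω \ {0}) = f ⁻¹' Ω \ {0} := by
    ext p
    simp
  have h := IsFormOperator.transfer_comp (𝒟' := testFunctions (f ⁻¹' Ω \ {0})) (P₁' := magneticX)
    (P₂' := magneticY) hf hinv (hΩ.diff (measurableSet_singleton 0)) measurable_phase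
    norm_phase hs (s₂ := -s) (by simpa using hs) (coreMemLp_magnetic Ω _)
    (coreMemLp_magnetic _ _) (fun φ hφ => phase_mul_comp_mem_testFunctions f hφ)
    (fun φ hφ => conj_phase_mul_comp_mem_testFunctions hinv hφ) (fun φ hφ p hp => by
      have := magnetic_phase_mul_comp (f := f) (α := s) (β := 0) (fun p => by simp [hfs])
        (by rw [← sq_abs, hs]; simp) (p := p) (by simpa using hp.2)
        (hφ.1.differentiable (by simp) (f p))
      rw [this.1, this.2]
      push_cast
      constructor <;> ring) hu
  rwa [e] at h

/-- The Aharonov–Bohm eigenvalues are invariant under the reflection in the diagonal. -/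
theorem abEigenvalues_swap_subset {Ω : Set (ℝ × ℝ)} (hΩ : MeasurableSet Ω) :
    abEigenvalues Ω ⊆ abEigenvalues (ContinuousLinearEquiv.prodComm ℝ ℝ ℝ ⁻¹' Ω) := by
  rintro z ⟨u, hu, H⟩
  set f := ContinuousLinearEquiv.prodComm ℝ ℝ ℝ
  have hf : MeasurePreserving f volume volume := Measure.measurePreserving_swap
  have hinv : Function.Involutive f := fun p => rfl
  have e : f ⁻¹' (Ω \ {0}) = f ⁻¹' Ω \ {0} := by
    ext p
    simp
  have hD := hΩ.diff (measurableSet_singleton (0 : ℝ × ℝ))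
  have h := IsFormOperator.transfer_comp (𝒟' := testFunctions (f ⁻¹' Ω \ {0})) (P₁' := magneticY)
    (P₂' := magneticX) hf hinv hD measurable_phase
    norm_phase (s₁ := 1) (s₂ := 1) (by simp) (by simp) (coreMemLp_magnetic Ω _)
    (fun φ hφ => have := coreMemLp_magnetic _ (f ⁻¹' (Ω \ {0})) φ hφ; ⟨this.1, this.2.2, this.2.1⟩)
    (fun φ hφ => phase_mul_comp_mem_testFunctions f hφ)
    (fun φ hφ => conj_phase_mul_comp_mem_testFunctions hinv hφ) (fun φ hφ p hp => by
      have := magnetic_phase_mul_comp (f := f) (α := 0) (β := 1) (fun p => by simp [f]; rfl)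
        (by simp) (p := p) (by simpa using hp.2)
        (hφ.1.differentiable (by simp) (f p))
      rw [this.1, this.2]
      push_cast
      constructor <;> ring) H
  have hne := not_ae_eq_zero_comp hf hinv hD norm_phase hu
  rw [e] at h hne
  exact formEigenvalues_swap ⟨_, hne, h⟩

theorem abEigenvalues_swap {Ω : Set (ℝ × ℝ)} (hΩ : MeasurableSet Ω) :
    abEigenvalues (ContinuousLinearEquiv.prodComm ℝ ℝ ℝ ⁻¹' Ω) = abEigenvalues Ω :=
  (abEigenvalues_swap_subset
    ((ContinuousLinearEquiv.prodComm ℝ ℝ ℝ).continuous.measurable hΩ)).antisymm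
    (abEigenvalues_swap_subset hΩ)

theorem mixedEigenvalues_reflect_subset {D N : Set (ℝ × ℝ)} (hD : MeasurableSet D)
    {f : (ℝ × ℝ) ≃L[ℝ] (ℝ × ℝ)} {s : ℝ} (hs : |s| = 1) (hfs : ∀ p, f p = (s * p.1, -(s * p.2)))
    (hf : MeasurePreserving f volume volume) (hinv : Function.Involutive f) :
    mixedEigenvalues D N ⊆ mixedEigenvalues (f ⁻¹' D) (f ⁻¹' N) := by
  rintro z ⟨u, hu, H⟩
  refine ⟨_, not_ae_eq_zero_comp (c := fun _ => (1 : ℂ)) hf hinv hD (by simp) hu, ?_⟩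
  refine IsFormOperator.transfer_comp (c := fun _ => (1 : ℂ)) hf hinv hD measurable_const
    (by simp) hs (s₂ := -s) (by simpa using hs) (coreMemLp_mixed _ _ _)
    (coreMemLp_mixed _ _ _) (fun φ hφ => ?_)
    (fun φ hφ => ?_) (fun φ hφ p hp => ?_) H
  · simpa using comp_mem_mixedTestFunctions f hφ
  · have := comp_mem_mixedTestFunctions f hφ
    rw [← preimage_comp, ← preimage_comp, hinv.comp_self] at this
    simpa using this
  · have := partial_comp (f := f) (α := s) (β := 0) (fun p => by simp [hfs])
      (hφ.1.differentiable (by simp) (f p))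
    simp only [one_mul]
    rw [this.1, this.2]
    push_cast
    constructor <;> ring

theorem mixedEigenvalues_reflect {D N : Set (ℝ × ℝ)} (hD : MeasurableSet D)
    {f : (ℝ × ℝ) ≃L[ℝ] (ℝ × ℝ)} {s : ℝ} (hs : |s| = 1) (hfs : ∀ p, f p = (s * p.1, -(s * p.2)))
    (hf : MeasurePreserving f volume volume) (hinv : Function.Involutive f) :
    mixedEigenvalues (f ⁻¹' D) (f ⁻¹' N) = mixedEigenvalues D N := by
  refine subset_antisymm ?_ (mixedEigenvalues_reflect_subset hD hs hfs hf hinv)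
  have := mixedEigenvalues_reflect_subset (N := f ⁻¹' N) (f.continuous.measurable hD)
    hs hfs hf hinv
  rwa [← preimage_comp, ← preimage_comp, hinv.comp_self] at this

theorem mixedEigenvalues_swap_subset {D N : Set (ℝ × ℝ)} (hD : MeasurableSet D) :
    mixedEigenvalues D N ⊆ mixedEigenvalues (ContinuousLinearEquiv.prodComm ℝ ℝ ℝ ⁻¹' D)
      (ContinuousLinearEquiv.prodComm ℝ ℝ ℝ ⁻¹' N) := by
  rintro z ⟨u, hu, H⟩
  set f := ContinuousLinearEquiv.prodComm ℝ ℝ ℝ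
  have hf : MeasurePreserving f volume volume := Measure.measurePreserving_swap
  have hinv : Function.Involutive f := fun p => rfl
  refine formEigenvalues_swap
    ⟨_, not_ae_eq_zero_comp (c := fun _ => (1 : ℂ)) hf hinv hD (by simp) hu, ?_⟩
  refine IsFormOperator.transfer_comp (c := fun _ => (1 : ℂ)) hf hinv hD measurable_const
    (by simp) (s₁ := 1) (s₂ := 1) (by simp) (by simp) (coreMemLp_mixed _ _ _)
    (fun φ hφ => have := coreMemLp_mixed _ _ _ φ hφ; ⟨this.1, this.2.2, this.2.1⟩)
    (fun φ hφ => ?_) (fun φ hφ => ?_) (fun φ hφ p hp => ?_) H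
  · simpa using comp_mem_mixedTestFunctions f hφ
  · have := comp_mem_mixedTestFunctions f hφ
    rw [← preimage_comp, ← preimage_comp, hinv.comp_self] at this
    simpa using this
  · have := partial_comp (f := f) (α := 0) (β := 1) (fun p => by simp [f]; rfl)
      (hφ.1.differentiable (by simp) (f p))
    simp only [one_mul]
    rw [this.1, this.2]
    push_cast
    constructor <;> ring

theorem mixedEigenvalues_swap {D N : Set (ℝ × ℝ)} (hD : MeasurableSet D) :
    mixedEigenvalues (ContinuousLinearEquiv.prodComm ℝ ℝ ℝ ⁻¹' D)
      (ContinuousLinearEquiv.prodComm ℝ ℝ ℝ ⁻¹' N) = mixedEigenvalues D N :=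
  (mixedEigenvalues_swap_subset
    ((ContinuousLinearEquiv.prodComm ℝ ℝ ℝ).continuous.measurable hD)).antisymm
    (mixedEigenvalues_swap_subset hD)

/-- The reflection `(x, y) ↦ (-x, y)`. -/
def reflectX : (ℝ × ℝ) ≃L[ℝ] (ℝ × ℝ) :=
  (ContinuousLinearEquiv.neg ℝ).prodCongr (ContinuousLinearEquiv.refl ℝ ℝ)

/-- The reflection `(x, y) ↦ (x, -y)`. -/
def reflectY : (ℝ × ℝ) ≃L[ℝ] (ℝ × ℝ) :=
  (ContinuousLinearEquiv.refl ℝ ℝ).prodCongr (ContinuousLinearEquiv.neg ℝ)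

theorem reflectX_apply (p : ℝ × ℝ) : reflectX p = (-p.1, p.2) := rfl

theorem reflectY_apply (p : ℝ × ℝ) : reflectY p = (p.1, -p.2) := rfl

theorem involutive_reflectX : Function.Involutive reflectX := fun p => by simp [reflectX_apply]

theorem involutive_reflectY : Function.Involutive reflectY := fun p => by simp [reflectY_apply]

theorem measurePreserving_reflectX : MeasurePreserving reflectX volume volume :=
  (Measure.measurePreserving_neg (volume : Measure ℝ)).prod (MeasurePreserving.id volume)

theorem measurePreserving_reflectY : MeasurePreserving reflectY volume volume :=
  (MeasurePreserving.id volume).prod (Measure.measurePreserving_neg (volume : Measure ℝ))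

/-! ### Doubly symmetric convex domains -/

/-- A convex open set with the symmetries of a rectangle, meeting the axes in open segments of
lengths `a` and `b`. -/
structure SymmetricDomain (Ω : Set (ℝ × ℝ)) (a b : ℝ) : Prop where
  pos_a : 0 < a
  pos_b : 0 < b
  isOpen : IsOpen Ω
  convex : Convex ℝ Ω
  reflectX_preimage : reflectX ⁻¹' Ω = Ω
  reflectY_preimage : reflectY ⁻¹' Ω = Ω
  mem_xAxis : ∀ x : ℝ, (x, (0 : ℝ)) ∈ Ω ↔ |x| < a / 2
  mem_yAxis : ∀ y : ℝ, ((0 : ℝ), y) ∈ Ω ↔ |y| < b / 2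

namespace SymmetricDomain

variable {Ω : Set (ℝ × ℝ)} {a b : ℝ}

theorem reflectX_mem (h : SymmetricDomain Ω a b) {p : ℝ × ℝ} : (-p.1, p.2) ∈ Ω ↔ p ∈ Ω := by
  conv_rhs => rw [← h.reflectX_preimage]
  rfl

theorem reflectY_mem (h : SymmetricDomain Ω a b) {p : ℝ × ℝ} : (p.1, -p.2) ∈ Ω ↔ p ∈ Ω := by
  conv_rhs => rw [← h.reflectY_preimage]
  rfl

theorem swap (h : SymmetricDomain Ω a b) :
    SymmetricDomain (ContinuousLinearEquiv.prodComm ℝ ℝ ℝ ⁻¹' Ω) b a where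
  pos_a := h.pos_b
  pos_b := h.pos_a
  isOpen := h.isOpen.preimage (ContinuousLinearEquiv.prodComm ℝ ℝ ℝ).continuous
  convex := h.convex.linear_preimage (ContinuousLinearEquiv.prodComm ℝ ℝ ℝ).toLinearMap
  reflectX_preimage := by
    ext p
    exact h.reflectY_mem (p := p.swap)
  reflectY_preimage := by
    ext p
    exact h.reflectX_mem (p := p.swap)
  mem_xAxis := h.mem_yAxis
  mem_yAxis := h.mem_xAxis

theorem abs_fst_lt (h : SymmetricDomain Ω a b) {p : ℝ × ℝ} (hp : p ∈ Ω) : |p.1| < a / 2 := by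
  rw [← h.mem_xAxis]
  have hc : Convex ℝ Ω := h.convex
  have := hc hp (h.reflectY_mem.2 hp) (by norm_num : (0 : ℝ) ≤ 1 / 2)
    (by norm_num : (0 : ℝ) ≤ 1 / 2) (by norm_num)
  convert this using 1
  ext <;> simp
  ring

theorem abs_snd_lt (h : SymmetricDomain Ω a b) {p : ℝ × ℝ} (hp : p ∈ Ω) : |p.2| < b / 2 :=
  h.swap.abs_fst_lt (p := p.swap) hp

theorem isBounded (h : SymmetricDomain Ω a b) : Bornology.IsBounded Ω := by
  refine (Metric.isBounded_closedBall (x := (0 : ℝ × ℝ)) (r := max (a / 2) (b / 2))).subset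
    fun p hp => ?_
  rw [mem_closedBall_zero_iff, Prod.norm_def]
  exact max_le_max (h.abs_fst_lt hp).le (h.abs_snd_lt hp).le

theorem abs_mem (h : SymmetricDomain Ω a b) {p : ℝ × ℝ} : (p.1, |p.2|) ∈ Ω ↔ p ∈ Ω := by
  rcases abs_choice p.2 with e | e <;> rw [e]
  exact h.reflectY_mem

theorem isOpen_upperHalf (h : SymmetricDomain Ω a b) : IsOpen (upperHalf Ω) :=
  h.isOpen.inter (isOpen_lt continuous_const continuous_snd)

theorem upperHalf_subset : upperHalf Ω ⊆ Ω \ {0} := fun p hp =>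
  ⟨hp.1, fun h => by have := hp.2; simp [mem_singleton_iff.1 h] at this⟩

/-- Folding the closure of `Ω` along the first axis leads into the closure of the upper half. -/
theorem abs_mem_closure_upperHalf (h : SymmetricDomain Ω a b) {p : ℝ × ℝ} (hp : p ∈ closure Ω) :
    (p.1, |p.2|) ∈ closure (upperHalf Ω) := by
  have hc : Continuous fun p : ℝ × ℝ => (p.1, |p.2|) := by fun_prop
  have hm : MapsTo (fun p : ℝ × ℝ => (p.1, |p.2|)) Ω (closure (upperHalf Ω)) := by
    intro q hq
    have ht : Filter.Tendsto (fun t : ℝ => (q.1, |q.2| + t)) (nhdsWithin 0 (Ioi 0))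
        (nhds (q.1, |q.2|)) := by
      have : Continuous fun t : ℝ => (q.1, |q.2| + t) := by fun_prop
      simpa using (this.tendsto 0).mono_left nhdsWithin_le_nhds
    refine mem_closure_of_tendsto ht ?_
    filter_upwards [ht.eventually (h.isOpen.mem_nhds (h.abs_mem.2 hq)), self_mem_nhdsWithin]
      with t ht1 ht2
    have h0 : 0 < |q.2| + t := add_pos_of_nonneg_of_pos (abs_nonneg _) ht2
    exact ⟨ht1, h0⟩
  exact isClosed_closure.closure_subset_iff.2 (mapsTo_iff_image_subset.1 hm |>.trans le_rfl)
    (image_closure_subset_closure_image hc (mem_image_of_mem _ hp))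

theorem abs_mem_frontier_upperHalf (h : SymmetricDomain Ω a b) {p : ℝ × ℝ} (hp : p ∈ closure Ω)
    (hp' : p ∉ Ω ∨ p.2 = 0) : (p.1, |p.2|) ∈ frontier (upperHalf Ω) := by
  rw [h.isOpen_upperHalf.frontier_eq]
  refine ⟨h.abs_mem_closure_upperHalf hp, fun hD => ?_⟩
  rcases hp' with hp' | hp'
  · exact hp' (h.abs_mem.1 hD.1)
  · have := hD.2
    simp [hp'] at this

/-- The right end of the Neumann segment is a limit of Dirichlet boundary points. -/
theorem corner_mem_closure (h : SymmetricDomain Ω a b) :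
    (a / 2, (0 : ℝ)) ∈ closure (frontier (upperHalf Ω) \ (Ioc 0 (a / 2) ×ˢ {0})) := by
  have ha := h.pos_a
  rw [Metric.mem_closure_iff]
  intro ε hε
  set t := min ε a / 2 with ht
  have ht0 : 0 < t := by positivity
  have htε : t < ε := by
    have := min_le_left ε a
    linarith
  have hta : t < a := by
    have := min_le_right ε a
    linarith
  have hin : (a / 2 - t, (0 : ℝ)) ∈ Ω := by
    rw [h.mem_xAxis, abs_lt]
    constructor <;> linarith
  have hcont : Continuous fun s : ℝ => (a / 2 - t, s) := by fun_prop
  obtain ⟨δ, hδ, hball⟩ := Metric.isOpen_iff.1 (h.isOpen.preimage hcont) 0 hin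
  set η := min δ ε / 2 with hη
  have hη0 : 0 < η := by positivity
  have hηδ : η < δ := by
    have := min_le_left δ ε
    linarith
  have hηε : η < ε := by
    have := min_le_right δ ε
    linarith
  have hinη : (a / 2 - t, η) ∈ Ω :=
    hball (by rw [Metric.mem_ball, Real.dist_eq, sub_zero, abs_of_pos hη0]; exact hηδ)
  have hout : (a / 2, η) ∉ Ω := fun hm => by
    have := h.abs_fst_lt hm
    rw [abs_of_pos (by positivity)] at this
    exact lt_irrefl _ this
  -- The horizontal segment at height `η` leaves `Ω` between abscissae `a / 2 - t` and `a / 2`.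
  have hpre : IsPreconnected (Icc (a / 2 - t) (a / 2) ×ˢ {η} : Set (ℝ × ℝ)) :=
    isPreconnected_Icc.prod isPreconnected_singleton
  obtain ⟨q, hq, hqf⟩ :
      ((Icc (a / 2 - t) (a / 2) ×ˢ {η} : Set (ℝ × ℝ)) ∩ frontier Ω).Nonempty := by
    by_contra hne
    rw [not_nonempty_iff_eq_empty] at hne
    have hcov : (Icc (a / 2 - t) (a / 2) ×ˢ {η} : Set (ℝ × ℝ)) ⊆ Ω ∪ (closure Ω)ᶜ := by
      intro q hq
      by_contra hn
      simp only [mem_union, mem_compl_iff, not_or, not_not] at hn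
      have : q ∈ (Icc (a / 2 - t) (a / 2) ×ˢ {η} : Set (ℝ × ℝ)) ∩ frontier Ω :=
        ⟨hq, by rw [h.isOpen.frontier_eq]; exact ⟨hn.2, hn.1⟩⟩
      rw [hne] at this
      exact this
    have m1 : (a / 2 - t, η) ∈ (Icc (a / 2 - t) (a / 2) ×ˢ {η} : Set (ℝ × ℝ)) :=
      ⟨⟨le_rfl, by simp; linarith⟩, rfl⟩
    have m2 : (a / 2, η) ∈ (Icc (a / 2 - t) (a / 2) ×ˢ {η} : Set (ℝ × ℝ)) :=
      ⟨⟨by simp; linarith, le_rfl⟩, rfl⟩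
    obtain ⟨q, -, hq1, hq2⟩ := hpre Ω (closure Ω)ᶜ h.isOpen isClosed_closure.isOpen_compl hcov
      ⟨_, m1, hinη⟩ ⟨_, m2, (hcov m2).resolve_left hout⟩
    exact hq2 (subset_closure hq1)
  have hq2 : q.2 = η := hq.2
  rw [h.isOpen.frontier_eq] at hqf
  have hqD := h.abs_mem_frontier_upperHalf hqf.1 (Or.inl hqf.2)
  rw [hq2, abs_of_pos hη0, ← hq2] at hqD
  refine ⟨q, ⟨hqD, fun hN => ?_⟩, ?_⟩
  · have : q.2 = 0 := hN.2
    linarith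
  · rw [Prod.dist_eq, max_lt_iff, Real.dist_eq, Real.dist_eq, hq2]
    have := hq.1.1
    have := hq.1.2
    constructor
    · rw [abs_of_nonneg (by simpa using hq.1.2)]
      simp only
      linarith
    · rwa [zero_sub, abs_neg, abs_of_pos hη0]

/-- The folded points of `closure Ω` that are outside `Ω` or on the cut belong to the closure of
the Dirichlet part of the boundary of the upper half. -/
theorem abs_mem_closure_dirichlet (h : SymmetricDomain Ω a b) {p : ℝ × ℝ} (hp : p ∈ closure Ω)
    (hp' : p ∉ Ω ∩ cutPlane) :
    (p.1, |p.2|) ∈ closure (frontier (upperHalf Ω) \ (Ioc 0 (a / 2) ×ˢ {0})) := by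
  by_cases hΩ : p ∈ Ω
  · have hc : ¬ (0 < p.1 ∨ p.2 ≠ 0) := fun hc => hp' ⟨hΩ, hc⟩
    simp only [not_or, not_lt, not_not] at hc
    exact subset_closure ⟨h.abs_mem_frontier_upperHalf hp (Or.inr hc.2),
      fun hN => absurd hN.1.1 (not_lt.2 hc.1)⟩
  · have hF := h.abs_mem_frontier_upperHalf hp (Or.inl hΩ)
    by_cases hN : (p.1, |p.2|) ∈ (Ioc 0 (a / 2) ×ˢ {0} : Set (ℝ × ℝ))
    · have h2 : |p.2| = 0 := hN.2
      have h1 : p.1 = a / 2 := by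
        refine le_antisymm hN.1.2 (not_lt.1 fun hlt => hΩ ?_)
        have := (h.mem_xAxis p.1).2 (by rw [abs_of_pos hN.1.1]; exact hlt)
        rwa [show ((p.1, (0 : ℝ)) : ℝ × ℝ) = p from Prod.ext rfl (abs_eq_zero.1 h2).symm] at this
      rw [h1, h2]
      exact h.corner_mem_closure
    · exact subset_closure ⟨hF, hN⟩

theorem closure_dirichlet_subset (h : SymmetricDomain Ω a b) :
    closure (frontier (upperHalf Ω) \ (Ioc 0 (a / 2) ×ˢ {0})) ⊆
      Ωᶜ ∪ {p | p.1 ≤ 0 ∧ p.2 = 0} := by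
  refine closure_minimal (fun p hp => ?_) (h.isOpen.isClosed_compl.union
    ((isClosed_le continuous_fst continuous_const).inter
      (isClosed_eq continuous_snd continuous_const)))
  obtain ⟨hF, hN⟩ := hp
  rw [h.isOpen_upperHalf.frontier_eq] at hF
  by_cases hΩ : p ∈ Ω
  · right
    have h0 : 0 ≤ p.2 := closure_minimal (s := upperHalf Ω) (t := {p | 0 ≤ p.2})
      (fun q hq => le_of_lt (show 0 < q.2 from hq.2))
      (isClosed_le continuous_const continuous_snd) hF.1
    have h2 : p.2 = 0 := le_antisymm (not_lt.1 fun hlt => hF.2 ⟨hΩ, hlt⟩) h0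
    exact ⟨not_lt.1 fun hlt => hN ⟨⟨hlt, (le_abs_self _).trans (h.abs_fst_lt hΩ).le⟩, h2⟩, h2⟩
  · exact Or.inl hΩ

end SymmetricDomain

/-! ### Approximation in form closures -/

section Approximation

variable {D : Set (ℝ × ℝ)} {𝒟 : Set (ℝ × ℝ → ℂ)} {P₁ P₂ : (ℝ × ℝ → ℂ) → (ℝ × ℝ → ℂ)}

/-- Bounded convergence in `L²` on a set of finite measure. -/
theorem tendsto_eLpNorm_sub_of_bounded {μ : Measure (ℝ × ℝ)} [IsFiniteMeasure μ]
    {ψ : ℕ → ℝ × ℝ → ℂ} {u : ℝ × ℝ → ℂ} {C : ℝ} (hψ : ∀ n, AEStronglyMeasurable (ψ n) μ)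
    (hb : ∀ᶠ n in Filter.atTop, ∀ᵐ p ∂μ, ‖ψ n p‖ ≤ C)
    (hl : ∀ᵐ p ∂μ, Filter.Tendsto (fun n => ψ n p) Filter.atTop (nhds (u p))) :
    MemLp u 2 μ ∧ Filter.Tendsto (fun n => eLpNorm (u - ψ n) 2 μ) Filter.atTop (nhds 0) := by
  have hu : AEStronglyMeasurable u μ := aestronglyMeasurable_of_tendsto_ae _ hψ hl
  obtain ⟨N, hN⟩ := Filter.eventually_atTop.1 hb
  have hub : ∀ᵐ p ∂μ, ‖u p‖ ≤ C := by
    have hall : ∀ᵐ p ∂μ, ∀ n, N ≤ n → ‖ψ n p‖ ≤ C :=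
      ae_all_iff.2 fun n => by
        by_cases hn : N ≤ n
        · filter_upwards [hN n hn] with p hp _ using hp
        · exact .of_forall fun p h => absurd h hn
    filter_upwards [hall, hl] with p h1 h2
    exact le_of_tendsto h2.norm (Filter.eventually_atTop.2 ⟨N, fun n hn => h1 n hn⟩)
  refine ⟨MemLp.of_bound hu C hub, ?_⟩
  have h2 : ∀ n, eLpNorm (u - ψ n) 2 μ = (∫⁻ p, ‖u p - ψ n p‖ₑ ^ (2 : ℝ) ∂μ) ^ (1 / 2 : ℝ) :=
    fun n => by
      rw [eLpNorm_eq_lintegral_rpow_enorm_toReal (by norm_num) (by norm_num)]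
      simp
  simp only [h2]
  have hlim : Filter.Tendsto (fun n => ∫⁻ p, ‖u p - ψ n p‖ₑ ^ (2 : ℝ) ∂μ) Filter.atTop
      (nhds (∫⁻ _, 0 ∂μ)) := by
    refine tendsto_lintegral_filter_of_dominated_convergence'
      (fun _ => ENNReal.ofReal (C + C) ^ (2 : ℝ)) ?_ ?_ ?_ ?_
    · exact .of_forall fun n => (hu.sub (hψ n)).enorm.pow_const _
    · filter_upwards [hb] with n hn
      filter_upwards [hn, hub] with p hp1 hp2
      gcongr
      rw [← ofReal_norm]
      exact ENNReal.ofReal_le_ofReal ((norm_sub_le _ _).trans (add_le_add hp2 hp1))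
    · simp [lintegral_const, ENNReal.mul_eq_top, measure_ne_top]
    · filter_upwards [hl] with p hp
      have : Filter.Tendsto (fun n => ‖u p - ψ n p‖ₑ) Filter.atTop (nhds 0) := by
        have := (tendsto_const_nhds (x := u p)).sub hp
        simpa using this.enorm
      simpa using this.ennrpow_const 2
  have := hlim.ennrpow_const (1 / 2)
  simpa using this

/-- A bounded sequence in the core whose jets converge almost everywhere converges in the form
closure. -/
theorem inFormClosure_of_bounded (hD : volume D ≠ ⊤) (hm : CoreMemLp D 𝒟 P₁ P₂)
    {ψ : ℕ → ℝ × ℝ → ℂ} {u g₁ g₂ : ℝ × ℝ → ℂ} {C : ℝ} (hψ : ∀ n, ψ n ∈ 𝒟)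
    (hb : ∀ᶠ n in Filter.atTop, ∀ᵐ p ∂(volume.restrict D),
      ‖ψ n p‖ ≤ C ∧ ‖P₁ (ψ n) p‖ ≤ C ∧ ‖P₂ (ψ n) p‖ ≤ C)
    (hl : ∀ᵐ p ∂(volume.restrict D),
      Filter.Tendsto (fun n => ψ n p) Filter.atTop (nhds (u p)) ∧
      Filter.Tendsto (fun n => P₁ (ψ n) p) Filter.atTop (nhds (g₁ p)) ∧
      Filter.Tendsto (fun n => P₂ (ψ n) p) Filter.atTop (nhds (g₂ p))) :
    InFormClosure D 𝒟 P₁ P₂ u g₁ g₂ := by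
  have : IsFiniteMeasure (volume.restrict D) := isFiniteMeasure_restrict.2 hD
  obtain ⟨m, t⟩ := tendsto_eLpNorm_sub_of_bounded (fun n => (hm _ (hψ n)).1.1)
    (hb.mono fun n hn => hn.mono fun p hp => hp.1) (hl.mono fun p hp => hp.1)
  obtain ⟨m₁, t₁⟩ := tendsto_eLpNorm_sub_of_bounded (fun n => (hm _ (hψ n)).2.1.1)
    (hb.mono fun n hn => hn.mono fun p hp => hp.2.1) (hl.mono fun p hp => hp.2.1)
  obtain ⟨m₂, t₂⟩ := tendsto_eLpNorm_sub_of_bounded (fun n => (hm _ (hψ n)).2.2.1)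
    (hb.mono fun n hn => hn.mono fun p hp => hp.2.2) (hl.mono fun p hp => hp.2.2)
  refine ⟨m, m₁, m₂, fun ε hε => ?_⟩
  obtain ⟨n, hn, hn₁, hn₂⟩ := ((t.eventually_lt_const hε).and
    ((t₁.eventually_lt_const hε).and (t₂.eventually_lt_const hε))).exists
  exact ⟨ψ n, hψ n, hn, hn₁, hn₂⟩

end Approximation

/-! ### Folding and unfolding -/

/-- The unfolding map: extend `u` from `D` by zero, extend the result to the reflected half with the
parity `s`, and restore the phase by the factor `κ e^{iθ/2}`. -/
noncomputable def unfold (D : Set (ℝ × ℝ)) (κ s : ℂ) : (ℝ × ℝ → ℂ) →ₗ[ℂ] (ℝ × ℝ → ℂ) :=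
  LinearMap.mulLeft ℂ (fun p => κ * halfPhase p) ∘ₗ
    (LinearMap.id + LinearMap.mulLeft ℂ (fun _ => s) ∘ₗ LinearMap.funLeft ℂ ℂ reflectY) ∘ₗ
    LinearMap.mulLeft ℂ (D.indicator 1)

/-- The folding map, adjoint to `unfold`. -/
noncomputable def fold (κ s : ℂ) : (ℝ × ℝ → ℂ) →ₗ[ℂ] (ℝ × ℝ → ℂ) :=
  (LinearMap.id ∘ₗ
    (LinearMap.id + LinearMap.funLeft ℂ ℂ reflectY ∘ₗ LinearMap.mulLeft ℂ (star fun _ => s))) ∘ₗ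
    LinearMap.mulLeft ℂ (star fun p => κ * halfPhase p)

theorem fold_apply (κ s : ℂ) (w : ℝ × ℝ → ℂ) (p : ℝ × ℝ) :
    fold κ s w p = conj (κ * halfPhase p) * w p
      + conj s * (conj (κ * halfPhase (reflectY p)) * w (reflectY p)) := by
  simp [fold, LinearMap.funLeft_apply]

theorem unfold_apply_of_pos {Ω : Set (ℝ × ℝ)} {κ s : ℂ} {u : ℝ × ℝ → ℂ} {p : ℝ × ℝ} (hp : p ∈ Ω)
    (h0 : 0 < p.2) : unfold (upperHalf Ω) κ s u p = κ * halfPhase p * u p := by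
  have h1 : p ∈ upperHalf Ω := ⟨hp, h0⟩
  have h2 : reflectY p ∉ upperHalf Ω := fun h => by
    have : 0 < (reflectY p).2 := h.2
    rw [reflectY_apply] at this
    simp only at this
    linarith
  simp [unfold, LinearMap.funLeft_apply, h1, h2]

theorem unfold_apply_of_neg {Ω : Set (ℝ × ℝ)} {κ s : ℂ} {u : ℝ × ℝ → ℂ} {p : ℝ × ℝ}
    (hp : reflectY p ∈ Ω) (h0 : p.2 < 0) :
    unfold (upperHalf Ω) κ s u p = κ * halfPhase p * (s * u (reflectY p)) := by
  have h1 : reflectY p ∈ upperHalf Ω := ⟨hp, by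
    show 0 < (reflectY p).2
    rw [reflectY_apply]
    simp only
    linarith⟩
  have h2 : p ∉ upperHalf Ω := fun h => by
    have : 0 < p.2 := h.2
    linarith
  simp [unfold, LinearMap.funLeft_apply, h1, h2]

theorem ae_snd_ne_zero : ∀ᵐ p : ℝ × ℝ, p.2 ≠ 0 := by
  have : volume ((univ : Set ℝ) ×ˢ ({0} : Set ℝ)) = 0 := by
    rw [Measure.volume_eq_prod, Measure.prod_prod]
    simp
  refine measure_mono_null (fun p hp => ?_) this
  exact ⟨mem_univ _, by simpa using hp⟩

namespace SymmetricDomain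

variable {Ω : Set (ℝ × ℝ)} {a b : ℝ}

theorem volume_ne_top (h : SymmetricDomain Ω a b) {D : Set (ℝ × ℝ)} (hD : D ⊆ Ω) :
    volume D ≠ ⊤ :=
  (h.isBounded.subset hD).measure_lt_top.ne

theorem l2Pair_unfold (h : SymmetricDomain Ω a b) {κ s : ℂ} (hκ : ‖κ‖ = 1) (hs : ‖s‖ = 1) :
    L2Pair (upperHalf Ω) (Ω \ {0}) (unfold (upperHalf Ω) κ s) (fold κ s) := by
  have hm : MeasurableSet (Ω \ {0}) :=
    h.isOpen.measurableSet.diff (measurableSet_singleton 0)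
  have e : reflectY ⁻¹' (Ω \ {0}) = Ω \ {0} := by
    ext p
    rw [preimage_sdiff, h.reflectY_preimage]
    simp
  have hR := L2Pair.comp measurePreserving_reflectY involutive_reflectY hm
  rw [e] at hR
  exact ((L2Pair.extend h.isOpen_upperHalf.measurableSet upperHalf_subset).trans
    (L2Pair.refl.add (hR.trans (L2Pair.mul measurable_const fun _ => hs.le)))).trans
    (L2Pair.mul (measurable_halfPhase.const_mul κ) fun p => by simp [hκ, norm_halfPhase])

end SymmetricDomain

theorem exists_bound_partial {φ : ℝ × ℝ → ℂ} (hφ : ContDiff ℝ ∞ φ) (hc : HasCompactSupport φ) :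
    ∃ C : ℝ, ∀ p, ‖φ p‖ ≤ C ∧ ‖partialX φ p‖ ≤ C ∧ ‖partialY φ p‖ ≤ C := by
  obtain ⟨C, hC⟩ := hφ.continuous.bounded_above_of_compact_support hc
  obtain ⟨C₁, hC₁⟩ := (continuous_partialX hφ).bounded_above_of_compact_support
    (hc.fderiv_apply ℝ _)
  obtain ⟨C₂, hC₂⟩ := (continuous_partialY hφ).bounded_above_of_compact_support
    (hc.fderiv_apply ℝ _)
  exact ⟨max C (max C₁ C₂), fun p => ⟨(hC p).trans (le_max_left _ _),
    (hC₁ p).trans ((le_max_left _ _).trans (le_max_right _ _)),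
    (hC₂ p).trans ((le_max_right _ _).trans (le_max_right _ _))⟩⟩

theorem exists_bound_deriv_smoothTransition :
    ∃ C : ℝ, 0 ≤ C ∧ (∀ t, |deriv Real.smoothTransition t| ≤ C) ∧
      ∀ t, 1 < t → deriv Real.smoothTransition t = 0 := by
  have hd1 : ∀ t, 1 < t → deriv Real.smoothTransition t = 0 := fun t ht => by
    have : Real.smoothTransition =ᶠ[nhds t] fun _ => 1 := by
      filter_upwards [lt_mem_nhds ht] with s hs
      exact Real.smoothTransition.one_of_one_le hs.le
    rw [this.deriv_eq, deriv_const]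
  have hd0 : ∀ t < 0, deriv Real.smoothTransition t = 0 := fun t ht => by
    have : Real.smoothTransition =ᶠ[nhds t] fun _ => 0 := by
      filter_upwards [gt_mem_nhds ht] with s hs
      exact Real.smoothTransition.zero_of_nonpos hs.le
    rw [this.deriv_eq, deriv_const]
  have hcont : Continuous (deriv Real.smoothTransition) :=
    (Real.smoothTransition.contDiff (n := 1)).continuous_deriv le_rfl
  obtain ⟨C, hC⟩ := isCompact_Icc.exists_bound_of_continuousOn (s := Icc (0 : ℝ) 1)
    hcont.continuousOn
  refine ⟨max C 0, le_max_right _ _, fun t => ?_, hd1⟩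
  by_cases ht : t ∈ Icc (0 : ℝ) 1
  · exact (hC t ht).trans (le_max_left _ _)
  · rw [mem_Icc, not_and_or, not_le, not_le] at ht
    rcases ht with ht | ht
    · simp [hd0 t ht]
    · simp [hd1 t ht]

/-- The product rule for a cutoff that depends on a linear form. -/
theorem partial_cutoff_mul {w : ℝ × ℝ → ℂ} {p : ℝ × ℝ} (hw : DifferentiableAt ℝ w p)
    (n c : ℝ) :
    partialX (fun q => (Real.smoothTransition (n * q.2 + c * q.1 - 1) : ℂ) * w q) p
      = Real.smoothTransition (n * p.2 + c * p.1 - 1) * partialX w p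
        + (c * deriv Real.smoothTransition (n * p.2 + c * p.1 - 1) : ℝ) * w p ∧
    partialY (fun q => (Real.smoothTransition (n * q.2 + c * q.1 - 1) : ℂ) * w q) p
      = Real.smoothTransition (n * p.2 + c * p.1 - 1) * partialY w p
        + (n * deriv Real.smoothTransition (n * p.2 + c * p.1 - 1) : ℝ) * w p := by
  have h1 : HasFDerivAt (fun q : ℝ × ℝ => n * q.2 + c * q.1 - 1) _ p :=
    (((hasFDerivAt_snd (𝕜 := ℝ) (p := p)).const_mul n).add
      ((hasFDerivAt_fst (𝕜 := ℝ) (p := p)).const_mul c)).sub_const 1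
  have h2 : HasDerivAt Real.smoothTransition _ (n * p.2 + c * p.1 - 1) :=
    ((Real.smoothTransition.contDiff (n := 1)).differentiable (by simp) _).hasDerivAt
  have h2' : HasFDerivAt (fun q : ℝ × ℝ => Real.smoothTransition (n * q.2 + c * q.1 - 1)) _ p :=
    HasDerivAt.comp_hasFDerivAt (h₂ := Real.smoothTransition) p h2 h1
  have h3 : HasFDerivAt
      (fun q : ℝ × ℝ => (Real.smoothTransition (n * q.2 + c * q.1 - 1) : ℂ)) _ p :=
    Complex.ofRealCLM.hasFDerivAt.comp p h2'
  constructor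
  · rw [partialX, partialX, fderiv_fun_mul h3.differentiableAt hw, h3.fderiv]
    simp
    ring
  · rw [partialY, partialY, fderiv_fun_mul h3.differentiableAt hw, h3.fderiv]
    simp
    ring

/-! ### Folding the Aharonov–Bohm core -/

namespace SymmetricDomain

variable {Ω : Set (ℝ × ℝ)} {a b : ℝ}

/-- A test function `Φ` on `Ω \ {0}` that vanishes on the negative first half-axis has, after
removing the phase, zero trace on the Dirichlet part of the boundary of the upper half.  Hence
`e^{-iθ/2} Φ` is in the form domain of the mixed problem.  The approximants are cut off by
`S (n y + c x - 1)`, with `S` a smooth step from `0` to `1`: this factor vanishes near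
`{x ≤ 0, y = 0}` and is `1` for `y > 0` where `x` is not small. -/
theorem inFormClosure_conj_halfPhase_mul (h : SymmetricDomain Ω a b) {Φ : ℝ × ℝ → ℂ}
    (hΦ : Φ ∈ testFunctions (Ω \ {0})) (hneg : ∀ x < 0, Φ (x, 0) = 0) :
    InFormClosure (upperHalf Ω) (mixedTestFunctions (upperHalf Ω) (Ioc 0 (a / 2) ×ˢ {0}))
      partialX partialY (fun p => conj (halfPhase p) * Φ p)
      (fun p => Complex.I * (conj (halfPhase p) * magneticX Φ p))
      (fun p => Complex.I * (conj (halfPhase p) * magneticY Φ p)) := by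
  -- `Φ` vanishes near the origin, hence on `{x < δ, y = 0}`.
  obtain ⟨δ, hδ, hδ0⟩ : ∃ δ > 0, ∀ x < δ, Φ (x, 0) = 0 := by
    have h0 : (0 : ℝ × ℝ) ∉ tsupport Φ := fun h0 => (hΦ.2.2 h0).2 rfl
    have hcont : Continuous fun x : ℝ => (x, (0 : ℝ)) := by fun_prop
    have hev := (hcont.tendsto 0).eventually (notMem_tsupport_iff_eventuallyEq.1 h0)
    obtain ⟨δ, hδ, hball⟩ := Metric.eventually_nhds_iff.1 hev
    refine ⟨δ, hδ, fun x hx => ?_⟩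
    by_cases hx0 : x < 0
    · exact hneg x hx0
    · exact hball (by rwa [Real.dist_eq, sub_zero, abs_of_nonneg (not_lt.1 hx0)])
  -- Hence `Φ` is `O(y)` on `{x < δ}`.
  obtain ⟨L, hL0, hL⟩ : ∃ L : ℝ, 0 ≤ L ∧ ∀ p : ℝ × ℝ, p.1 < δ → ‖Φ p‖ ≤ L * |p.2| := by
    obtain ⟨L, hL⟩ := (hΦ.1.continuous_fderiv (by simp)).bounded_above_of_compact_support
      (hΦ.2.1.fderiv ℝ)
    refine ⟨L, (norm_nonneg _).trans (hL 0), fun p hp => ?_⟩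
    have := convex_univ.norm_image_sub_le_of_norm_fderiv_le (𝕜 := ℝ) (f := Φ) (x := (p.1, 0))
      (y := p) (fun q _ => hΦ.1.differentiable (by simp) q) (fun q _ => hL q) (mem_univ _)
      (mem_univ _)
    rw [hδ0 _ hp, sub_zero] at this
    refine this.trans_eq ?_
    congr 1
    simp [Prod.norm_def]
  obtain ⟨C, hC⟩ := hΦ.1.continuous.bounded_above_of_compact_support hΦ.2.1
  obtain ⟨hXs, hXc, -⟩ := magneticX_mem_testFunctions hΦ
  obtain ⟨hYs, hYc, -⟩ := magneticY_mem_testFunctions hΦ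
  obtain ⟨C₁, hC₁⟩ := hXs.continuous.bounded_above_of_compact_support hXc
  obtain ⟨C₂, hC₂⟩ := hYs.continuous.bounded_above_of_compact_support hYc
  obtain ⟨K, hK0, hK, hK1⟩ := exists_bound_deriv_smoothTransition
  have hC0 : 0 ≤ C := (norm_nonneg _).trans (hC 0)
  have hC10 : 0 ≤ C₁ := (norm_nonneg _).trans (hC₁ 0)
  have hC20 : 0 ≤ C₂ := (norm_nonneg _).trans (hC₂ 0)
  set c : ℝ := 2 / δ with hc
  have hc0 : 0 < c := by positivity
  have hcδ : c * δ = 2 := div_mul_cancel₀ 2 hδ.ne'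
  set w : ℝ × ℝ → ℂ := fun p => conj (halfPhase p) * Φ p with hw
  have hnorm : ∀ (p : ℝ × ℝ) (v : ℂ), ‖conj (halfPhase p) * v‖ = ‖v‖ := fun p v => by
    rw [norm_mul, Complex.norm_conj, norm_halfPhase, one_mul]
  have hws : ∀ p ∈ cutPlane, ContDiffAt ℝ ∞ w p := fun p hp =>
    (Complex.conjCLE.contDiff.contDiffAt.comp p (contDiffAt_halfPhase hp)).mul hΦ.1.contDiffAt
  have hwX : ∀ p ∈ cutPlane, partialX w p = Complex.I * (conj (halfPhase p) * magneticX Φ p) :=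
    fun p hp => (partial_conj_halfPhase_mul hp (hΦ.1.differentiable (by simp) p)).1
  have hwY : ∀ p ∈ cutPlane, partialY w p = Complex.I * (conj (halfPhase p) * magneticY Φ p) :=
    fun p hp => (partial_conj_halfPhase_mul hp (hΦ.1.differentiable (by simp) p)).2
  set ψ : ℕ → ℝ × ℝ → ℂ := fun n p =>
    (Real.smoothTransition (n * p.2 + c * p.1 - 1) : ℂ) * w p with hψ
  have hlin : ∀ n : ℕ, Continuous fun p : ℝ × ℝ => (n : ℝ) * p.2 + c * p.1 := fun n => by
    fun_prop
  have hD : ∀ p ∈ upperHalf Ω, 0 < p.2 ∧ p ∈ cutPlane ∧ |p.1| < a / 2 := fun p hp =>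
    ⟨hp.2, Or.inr (ne_of_gt hp.2), h.abs_fst_lt hp.1⟩
  refine inFormClosure_of_bounded (ψ := ψ)
    (C := max C (max (C₁ + c * K * C) (C₂ + K * (L * (2 + c * (a / 2))))))
    (h.volume_ne_top fun p hp => hp.1)
    (coreMemLp_mixed _ _ _) (fun n => ?_) ?_ ?_
  · have hsupp : tsupport (ψ n) ⊆ tsupport Φ ∩ {p | 1 ≤ (n : ℝ) * p.2 + c * p.1} := by
      refine closure_minimal (fun p hp => ?_)
        ((isClosed_tsupport _).inter (isClosed_le continuous_const (hlin n)))
      refine ⟨subset_tsupport _ fun h0 => hp (by simp [hψ, hw, h0]), ?_⟩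
      show 1 ≤ (n : ℝ) * p.2 + c * p.1
      by_contra hlt
      exact hp (by simp [hψ, Real.smoothTransition.zero_of_nonpos
        (show (n : ℝ) * p.2 + c * p.1 - 1 ≤ 0 by linarith)])
    refine ⟨contDiff_iff_contDiffAt.2 fun p => ?_, ?_, ?_⟩
    · by_cases hp : p ∈ cutPlane
      · have hlin' : ContDiff ℝ ∞ fun p : ℝ × ℝ => (n : ℝ) * p.2 + c * p.1 - 1 := by fun_prop
        exact (Complex.ofRealCLM.contDiff.comp
          (Real.smoothTransition.contDiff.comp hlin')).contDiffAt.mul (hws p hp)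
      · have hp1 : p.1 ≤ 0 := not_lt.1 fun h => hp (Or.inl h)
        have hp2 : p.2 = 0 := not_not.1 fun h => hp (Or.inr h)
        have hn : p ∉ tsupport (ψ n) := fun hs => by
          have : 1 ≤ (n : ℝ) * p.2 + c * p.1 := (hsupp hs).2
          rw [hp2, mul_zero, zero_add] at this
          linarith [mul_nonpos_of_nonneg_of_nonpos hc0.le hp1]
        exact contDiffAt_const.congr_of_eventuallyEq (notMem_tsupport_iff_eventuallyEq.1 hn)
    · exact hΦ.2.1.of_isClosed_subset (isClosed_tsupport _) (hsupp.trans inter_subset_left)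
    · rw [disjoint_left]
      intro p hp hF
      obtain ⟨hp1, hp2⟩ := hsupp hp
      rcases h.closure_dirichlet_subset hF with hF | hF
      · exact hF (hΦ.2.2 hp1).1
      · have e1 : p.1 ≤ 0 := hF.1
        have e2 : p.2 = 0 := hF.2
        have : 1 ≤ (n : ℝ) * p.2 + c * p.1 := hp2
        rw [e2, mul_zero, zero_add] at this
        linarith [mul_nonpos_of_nonneg_of_nonpos hc0.le e1]
  · filter_upwards [Filter.eventually_ge_atTop 1] with n hn
    filter_upwards [ae_restrict_mem h.isOpen_upperHalf.measurableSet] with p hp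
    obtain ⟨hp0, hpc, hpa⟩ := hD p hp
    have hn1 : (1 : ℝ) ≤ n := by exact_mod_cast hn
    obtain ⟨dX, dY⟩ := partial_cutoff_mul ((hws p hpc).differentiableAt (by simp)) n c
    set t : ℝ := n * p.2 + c * p.1 - 1 with ht
    have hS : ‖(Real.smoothTransition t : ℂ)‖ ≤ 1 := by
      rw [Complex.norm_real, Real.norm_of_nonneg (Real.smoothTransition.nonneg t)]
      exact Real.smoothTransition.le_one t
    have hmul : ∀ v : ℂ, ‖(Real.smoothTransition t : ℂ) * v‖ ≤ ‖v‖ := fun v => by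
      rw [norm_mul]
      exact mul_le_of_le_one_left (norm_nonneg _) hS
    have hwn : ‖w p‖ = ‖Φ p‖ := hnorm _ _
    refine ⟨?_, ?_, ?_⟩
    · exact ((hmul _).trans (hwn.trans_le (hC p))).trans (le_max_left _ _)
    · refine le_trans ?_ ((le_max_left _ _).trans (le_max_right _ _))
      rw [dX, hwX p hpc]
      refine (norm_add_le _ _).trans (add_le_add ((hmul _).trans ?_) ?_)
      · rw [norm_mul, Complex.norm_I, one_mul, hnorm]
        exact hC₁ p
      · rw [norm_mul, Complex.norm_real, norm_mul, Real.norm_of_nonneg hc0.le, hwn]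
        have := hK t
        gcongr
        · exact this
        · exact hC p
    · refine le_trans ?_ ((le_max_right _ _).trans (le_max_right _ _))
      rw [dY, hwY p hpc]
      refine (norm_add_le _ _).trans (add_le_add ((hmul _).trans ?_) ?_)
      · rw [norm_mul, Complex.norm_I, one_mul, hnorm]
        exact hC₂ p
      · -- Where the cutoff varies, `n y ≤ 2 - c x`; this is possible only for `x < δ`, where
        -- `n * ‖Φ‖ ≤ L * (n y)`.
        rw [norm_mul, Complex.norm_real, norm_mul, Real.norm_of_nonneg (by positivity), hwn]
        by_cases ht1 : 1 < t
        · rw [hK1 t ht1, norm_zero, mul_zero, zero_mul]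
          have := h.pos_a
          positivity
        · have hny : (n : ℝ) * p.2 ≤ 2 - c * p.1 := by linarith
          have hpos : 0 < (n : ℝ) * p.2 := by positivity
          have hxδ : p.1 < δ := by
            by_contra hge
            have := mul_le_mul_of_nonneg_left (not_lt.1 hge) hc0.le
            linarith
          have hΦp := hL p hxδ
          rw [abs_of_pos hp0] at hΦp
          have hca : -(c * p.1) ≤ c * (a / 2) := by
            have := mul_le_mul_of_nonneg_left ((neg_le_abs p.1).trans hpa.le) hc0.le
            linarith
          calc (n : ℝ) * ‖deriv Real.smoothTransition t‖ * ‖Φ p‖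
              ≤ n * K * (L * p.2) := by
                have := hK t
                gcongr
                exact this
            _ = K * (L * (n * p.2)) := by ring
            _ ≤ K * (L * (2 + c * (a / 2))) := by
                gcongr
                linarith
  · filter_upwards [ae_restrict_mem h.isOpen_upperHalf.measurableSet] with p hp
    obtain ⟨hp0, hpc, hpa⟩ := hD p hp
    have hev : ∀ᶠ n : ℕ in Filter.atTop, 1 < (n : ℝ) * p.2 + c * p.1 - 1 := by
      have : Filter.Tendsto (fun n : ℕ => (n : ℝ) * p.2 + (c * p.1 - 1)) Filter.atTop
          Filter.atTop := Filter.tendsto_atTop_add_const_right _ _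
            (tendsto_natCast_atTop_atTop.atTop_mul_const hp0)
      filter_upwards [this.eventually_gt_atTop 1] with n hn
      linarith
    have key : ∀ n : ℕ, 1 < (n : ℝ) * p.2 + c * p.1 - 1 → ψ n p = w p ∧
        partialX (ψ n) p = partialX w p ∧ partialY (ψ n) p = partialY w p := fun n hn => by
      obtain ⟨dX, dY⟩ := partial_cutoff_mul ((hws p hpc).differentiableAt (by simp)) n c
      have e1 := Real.smoothTransition.one_of_one_le hn.le
      have e2 := hK1 _ hn
      refine ⟨?_, ?_, ?_⟩
      · simp only [hψ, e1, Complex.ofReal_one, one_mul]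
      · rw [dX, e1, e2]
        simp
      · rw [dY, e1, e2]
        simp
    rw [← hwX p hpc, ← hwY p hpc]
    exact ⟨tendsto_const_nhds.congr' (hev.mono fun n hn => (key n hn).1.symm),
      tendsto_const_nhds.congr' (hev.mono fun n hn => (key n hn).2.1.symm),
      tendsto_const_nhds.congr' (hev.mono fun n hn => (key n hn).2.2.symm)⟩

/-- Folding maps the Aharonov–Bohm core into the form domain of the mixed problem. -/
theorem inFormClosure_fold (h : SymmetricDomain Ω a b) {φ : ℝ × ℝ → ℂ}
    (hφ : φ ∈ testFunctions (Ω \ {0})) :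
    InFormClosure (upperHalf Ω) (mixedTestFunctions (upperHalf Ω) (Ioc 0 (a / 2) ×ˢ {0}))
      partialX partialY (fold 1 1 φ) (fold (-Complex.I) 1 (magneticX φ))
      (fold (-Complex.I) (-1) (magneticY φ)) := by
  set φ' : ℝ × ℝ → ℂ := fun p => phase p * φ (reflectY p) with hφ'
  have m' : φ' ∈ testFunctions (Ω \ {0}) := by
    have := phase_mul_comp_mem_testFunctions reflectY hφ
    rwa [h.reflectY_preimage] at this
  have hd : Differentiable ℝ φ := hφ.1.differentiable (by simp)
  have hd' : Differentiable ℝ φ' := m'.1.differentiable (by simp)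
  have H := h.inFormClosure_conj_halfPhase_mul (add_mem_testFunctions hφ m') (fun x hx => by
    simp [hφ', reflectY_apply, phase_of_neg_axis (p := (x, 0)) hx rfl])
  have hmem := ae_restrict_mem (μ := volume) h.isOpen_upperHalf.measurableSet
  have hc : ∀ p ∈ upperHalf Ω, p ∈ cutPlane ∧ p ≠ 0 := fun p hp =>
    have hc : p ∈ cutPlane := Or.inr (ne_of_gt hp.2)
    ⟨hc, ne_zero_of_mem_cutPlane hc⟩
  have hh : ∀ p ∈ cutPlane, conj (halfPhase (reflectY p)) = conj (halfPhase p) * phase p :=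
    fun p hp => by
      rw [reflectY_apply, halfPhase_reflect hp, Complex.conj_conj, conj_halfPhase_mul_phase]
  have hmag := fun (p : ℝ × ℝ) (hp : p ≠ 0) => magnetic_phase_mul_comp (f := reflectY) (α := 1)
    (β := 0) (fun p => by simp [reflectY_apply]) (by simp) hp (hd (reflectY p))
  refine H.congr_ae ?_ ?_ ?_
  · filter_upwards [hmem] with p hp
    rw [fold_apply]
    simp only [map_one, one_mul, hh p (hc p hp).1, hφ']
    ring
  · filter_upwards [hmem] with p hp
    have e : magneticX (fun q => φ q + φ' q) p = magneticX φ p + magneticX φ' p := by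
      simp only [magneticX, partialX, fderiv_fun_add (hd p) (hd' p),
        add_apply]
      ring
    rw [fold_apply, e, (hmag p (hc p hp).2).1]
    simp only [map_mul, map_one, map_neg, Complex.conj_I, hh p (hc p hp).1, Complex.ofReal_one,
      Complex.ofReal_zero]
    ring
  · filter_upwards [hmem] with p hp
    have e : magneticY (fun q => φ q + φ' q) p = magneticY φ p + magneticY φ' p := by
      simp only [magneticY, partialY, fderiv_fun_add (hd p) (hd' p),
        add_apply]
      ring
    rw [fold_apply, e, (hmag p (hc p hp).2).2]
    simp only [map_mul, map_one, map_neg, Complex.conj_I, hh p (hc p hp).1, Complex.ofReal_one,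
      Complex.ofReal_zero]
    ring

end SymmetricDomain

/-! ### Unfolding the mixed core -/

/-- The derivatives of `φ(x, √(y² + ε²))`, a smooth substitute for the even extension of `φ`. -/
theorem partial_comp_sqrt {φ : ℝ × ℝ → ℂ} (hφ : ContDiff ℝ ∞ φ) {ε : ℝ} (hε : 0 < ε) :
    ContDiff ℝ ∞ (fun q : ℝ × ℝ => φ (q.1, √(q.2 ^ 2 + ε ^ 2))) ∧ ∀ p : ℝ × ℝ,
    partialX (fun q : ℝ × ℝ => φ (q.1, √(q.2 ^ 2 + ε ^ 2))) p
      = partialX φ (p.1, √(p.2 ^ 2 + ε ^ 2)) ∧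
    partialY (fun q : ℝ × ℝ => φ (q.1, √(q.2 ^ 2 + ε ^ 2))) p
      = (p.2 / √(p.2 ^ 2 + ε ^ 2) : ℝ) * partialY φ (p.1, √(p.2 ^ 2 + ε ^ 2)) := by
  have hne : ∀ y : ℝ, y ^ 2 + ε ^ 2 ≠ 0 := fun y => by positivity
  refine ⟨hφ.comp (contDiff_fst.prodMk
    (((contDiff_snd.pow 2).add contDiff_const).sqrt fun p => hne p.2)), fun p => ?_⟩
  have h1 : HasFDerivAt (fun q : ℝ × ℝ => √(q.2 ^ 2 + ε ^ 2)) _ p :=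
    (((hasFDerivAt_snd (𝕜 := ℝ) (p := p)).pow 2).add_const (ε ^ 2)).sqrt (hne p.2)
  have h2 : HasFDerivAt (fun q : ℝ × ℝ => (q.1, √(q.2 ^ 2 + ε ^ 2))) _ p :=
    (hasFDerivAt_fst (𝕜 := ℝ) (p := p)).prodMk h1
  have h3 := ((hφ.differentiable (by simp) _).hasFDerivAt).comp p h2
  have lin : ∀ (q : ℝ × ℝ) (t : ℝ), fderiv ℝ φ q (0, t) = t * fderiv ℝ φ q (0, 1) := fun q t => by
    have : ((0, t) : ℝ × ℝ) = t • (0, 1) := by ext <;> simp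
    rw [this, map_smul]
    simp
  constructor
  · rw [partialX, partialX]
    refine (congrArg (fun l => l ((1, 0) : ℝ × ℝ)) h3.fderiv).trans ?_
    simp
  · rw [partialY, partialY]
    refine (congrArg (fun l => l ((0, 1) : ℝ × ℝ)) h3.fderiv).trans ?_
    simp
    rw [lin]
    push_cast
    ring

namespace SymmetricDomain

variable {Ω : Set (ℝ × ℝ)} {a b : ℝ}

/-- Unfolding maps the core of the mixed problem into the Aharonov–Bohm form domain: the even
extension `φ(x, |y|)` is approximated by `φ(x, √(y² + ε²))`. -/
theorem inFormClosure_unfold (h : SymmetricDomain Ω a b) {φ : ℝ × ℝ → ℂ}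
    (hφ : φ ∈ mixedTestFunctions (upperHalf Ω) (Ioc 0 (a / 2) ×ˢ {0})) :
    InFormClosure (Ω \ {0}) (testFunctions (Ω \ {0})) magneticX magneticY
      (unfold (upperHalf Ω) 1 1 φ) (unfold (upperHalf Ω) (-Complex.I) 1 (partialX φ))
      (unfold (upperHalf Ω) (-Complex.I) (-1) (partialY φ)) := by
  obtain ⟨hφs, hφc, hφd⟩ := hφ
  obtain ⟨C, hC⟩ := exists_bound_partial hφs hφc
  obtain ⟨δ, hδ, hdist⟩ := Metric.exists_pos_forall_lt_edist hφc isClosed_closure hφd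
  have hδ0 : (0 : ℝ) < δ := hδ
  set ε : ℕ → ℝ := fun n => δ / (n + 1) with hε
  have hε0 : ∀ n, 0 < ε n := fun n => by positivity
  have hεδ : ∀ n, ε n ≤ δ := fun n => div_le_self hδ0.le (by simp)
  have hεlim : Filter.Tendsto ε Filter.atTop (nhds 0) :=
    by simpa [hε, div_eq_mul_inv] using
      (tendsto_one_div_add_atTop_nhds_zero_nat (𝕜 := ℝ)).const_mul (δ : ℝ)
  set g : ℕ → ℝ × ℝ → ℂ := fun n p => φ (p.1, √(p.2 ^ 2 + ε n ^ 2)) with hg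
  have hgs : ∀ n, ContDiff ℝ ∞ (g n) := fun n => (partial_comp_sqrt hφs (hε0 n)).1
  -- The cut-off even extension is a test function on the cut domain.
  have hw : ∀ n, Ω.indicator (g n) ∈ testFunctions (Ω ∩ cutPlane) := by
    intro n
    set K : Set (ℝ × ℝ) := closure Ω ∩ {p | (p.1, √(p.2 ^ 2 + ε n ^ 2)) ∈ tsupport φ} with hK
    have hKc : IsClosed K := isClosed_closure.inter
      ((isClosed_tsupport φ).preimage (by fun_prop :
        Continuous fun p : ℝ × ℝ => (p.1, √(p.2 ^ 2 + ε n ^ 2))))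
    have hsupp : tsupport (Ω.indicator (g n)) ⊆ K := by
      refine closure_minimal (fun p hp => ?_) hKc
      have hpΩ : p ∈ Ω := by
        by_contra hn
        exact hp (indicator_of_notMem hn _)
      refine ⟨subset_closure hpΩ, subset_tsupport _ fun h0 => hp ?_⟩
      rw [indicator_of_mem hpΩ]
      exact h0
    have hKU : K ⊆ Ω ∩ cutPlane := by
      intro p hp
      by_contra hn
      have hlt := hdist _ hp.2 _ (h.abs_mem_closure_dirichlet hp.1 hn)
      rw [edist_dist, ENNReal.lt_ofReal_iff_toReal_lt ENNReal.coe_ne_top, Prod.dist_eq,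
        ENNReal.coe_toReal] at hlt
      simp only [dist_self] at hlt
      have hsq : √(p.2 ^ 2 + ε n ^ 2) ≤ |p.2| + ε n := by
        rw [Real.sqrt_le_left (by have := hε0 n; positivity)]
        nlinarith [sq_abs p.2, abs_nonneg p.2, hε0 n]
      have hsq' : |p.2| ≤ √(p.2 ^ 2 + ε n ^ 2) :=
        Real.abs_le_sqrt (by nlinarith [hε0 n])
      rw [Real.dist_eq, abs_of_nonneg (sub_nonneg.2 hsq'), lt_max_iff] at hlt
      have := hεδ n
      rcases hlt with hlt | hlt <;> linarith
    refine ⟨contDiff_iff_contDiffAt.2 fun p => ?_, ?_, hsupp.trans hKU⟩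
    · by_cases hp : p ∈ Ω
      · refine (hgs n).contDiffAt.congr_of_eventuallyEq ?_
        filter_upwards [h.isOpen.mem_nhds hp] with q hq using indicator_of_mem hq _
      · exact contDiffAt_const.congr_of_eventuallyEq
          (notMem_tsupport_iff_eventuallyEq.1 fun hs => hp (hKU (hsupp hs)).1)
    · exact h.isBounded.isCompact_closure.of_isClosed_subset (isClosed_tsupport _)
        (hsupp.trans inter_subset_left)
  set ψ : ℕ → ℝ × ℝ → ℂ := fun n p => halfPhase p * Ω.indicator (g n) p with hψ
  have hψm : ∀ n, ψ n ∈ testFunctions (Ω \ {0}) := fun n => by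
    obtain ⟨h1, h2, h3⟩ := mul_mem_testFunctions (fun p hp => contDiffAt_halfPhase hp.2) (hw n)
    exact ⟨h1, h2, h3.trans fun p hp => ⟨hp.1, ne_zero_of_mem_cutPlane hp.2⟩⟩
  have hval : ∀ n, ∀ p ∈ Ω, p.2 ≠ 0 →
      ψ n p = halfPhase p * φ (p.1, √(p.2 ^ 2 + ε n ^ 2)) ∧
      magneticX (ψ n) p
        = halfPhase p * (-Complex.I * partialX φ (p.1, √(p.2 ^ 2 + ε n ^ 2))) ∧
      magneticY (ψ n) p = halfPhase p * (-Complex.I * ((p.2 / √(p.2 ^ 2 + ε n ^ 2) : ℝ)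
        * partialY φ (p.1, √(p.2 ^ 2 + ε n ^ 2)))) := by
    intro n p hp hp2
    have hev : Ω.indicator (g n) =ᶠ[nhds p] g n := by
      filter_upwards [h.isOpen.mem_nhds hp] with q hq using indicator_of_mem hq _
    obtain ⟨mX, mY⟩ := magnetic_halfPhase_mul (p := p) (Or.inr hp2)
      ((hw n).1.differentiable (by simp) p)
    obtain ⟨dX, dY⟩ := (partial_comp_sqrt hφs (hε0 n)).2 p
    refine ⟨?_, ?_, ?_⟩
    · simp only [hψ, indicator_of_mem hp, hg]
    · rw [mX, partialX, hev.fderiv_eq, ← dX]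
      rfl
    · rw [mY, partialY, hev.fderiv_eq, ← dY]
      rfl
  have hae : ∀ᵐ p ∂(volume.restrict (Ω \ {0})), p ∈ Ω ∧ p.2 ≠ 0 := by
    filter_upwards [ae_restrict_mem (h.isOpen.measurableSet.diff (measurableSet_singleton 0)),
      ae_restrict_of_ae ae_snd_ne_zero] with p hp hp2 using ⟨hp.1, hp2⟩
  refine inFormClosure_of_bounded (C := C) (h.volume_ne_top sdiff_subset)
    (coreMemLp_magnetic _ _) hψm (.of_forall fun n => ?_) ?_
  · filter_upwards [hae] with p hp
    obtain ⟨e, eX, eY⟩ := hval n p hp.1 hp.2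
    obtain ⟨c, cX, cY⟩ := hC (p.1, √(p.2 ^ 2 + ε n ^ 2))
    rw [e, eX, eY]
    simp only [norm_mul, norm_halfPhase, norm_neg, Complex.norm_I, one_mul, Complex.norm_real]
    refine ⟨c, cX, (mul_le_of_le_one_left (norm_nonneg _) ?_).trans cY⟩
    rw [Real.norm_eq_abs, abs_div, abs_of_nonneg (Real.sqrt_nonneg _)]
    exact div_le_one_of_le₀ (Real.abs_le_sqrt (by nlinarith [hε0 n])) (Real.sqrt_nonneg _)
  · filter_upwards [hae] with p hp
    have hsq : Filter.Tendsto (fun n => √(p.2 ^ 2 + ε n ^ 2)) Filter.atTop (nhds |p.2|) := by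
      have hc : Continuous fun t : ℝ => √(p.2 ^ 2 + t ^ 2) := by fun_prop
      simpa [Real.sqrt_sq_eq_abs, Function.comp_def] using (hc.tendsto 0).comp hεlim
    have hpt : Filter.Tendsto (fun n => (p.1, √(p.2 ^ 2 + ε n ^ 2))) Filter.atTop
        (nhds (p.1, |p.2|)) := tendsto_const_nhds.prodMk_nhds hsq
    have t := ((hφs.continuous.tendsto _).comp hpt).const_mul (halfPhase p)
    have tX := ((((continuous_partialX hφs).tendsto _).comp hpt).const_mul
      (-Complex.I)).const_mul (halfPhase p)
    have hq : Filter.Tendsto (fun n => ((p.2 / √(p.2 ^ 2 + ε n ^ 2) : ℝ) : ℂ)) Filter.atTop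
        (nhds ((p.2 / |p.2| : ℝ) : ℂ)) :=
      (Complex.continuous_ofReal.tendsto _).comp
        (tendsto_const_nhds.div hsq (abs_ne_zero.2 hp.2))
    have tY := ((hq.mul (((continuous_partialY hφs).tendsto _).comp hpt)).const_mul
      (-Complex.I)).const_mul (halfPhase p)
    have hv := fun n => hval n p hp.1 hp.2
    simp only [fun n => (hv n).1, fun n => (hv n).2.1, fun n => (hv n).2.2]
    rcases lt_or_gt_of_ne hp.2 with hneg | hpos
    · have hR : reflectY p ∈ Ω := h.reflectY_mem.2 hp.1
      have e : (p.1, |p.2|) = reflectY p := by rw [reflectY_apply, abs_of_neg hneg]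
      have e1 : p.2 / |p.2| = -1 := by rw [abs_of_neg hneg, div_neg, div_self hp.2]
      rw [e] at t tX tY
      rw [e1] at tY
      rw [unfold_apply_of_neg hR hneg, unfold_apply_of_neg hR hneg, unfold_apply_of_neg hR hneg]
      refine ⟨?_, ?_, ?_⟩
      · rw [show (1 : ℂ) * halfPhase p * (1 * φ (reflectY p))
          = halfPhase p * φ (reflectY p) by ring]
        exact t
      · rw [show -Complex.I * halfPhase p * (1 * partialX φ (reflectY p))
          = halfPhase p * (-Complex.I * partialX φ (reflectY p)) by ring]
        exact tX
      · rw [show -Complex.I * halfPhase p * (-1 * partialY φ (reflectY p))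
            = halfPhase p * (-Complex.I * ((-1 : ℝ) * partialY φ (reflectY p))) by
          push_cast
          ring]
        exact tY
    · have e : (p.1, |p.2|) = p := by rw [abs_of_pos hpos]
      have e1 : p.2 / |p.2| = 1 := by rw [abs_of_pos hpos, div_self hp.2]
      rw [e] at t tX tY
      rw [e1] at tY
      rw [unfold_apply_of_pos hp.1 hpos, unfold_apply_of_pos hp.1 hpos,
        unfold_apply_of_pos hp.1 hpos]
      refine ⟨?_, ?_, ?_⟩
      · rw [show (1 : ℂ) * halfPhase p * φ p
          = halfPhase p * φ p by ring]
        exact t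
      · rw [show -Complex.I * halfPhase p * partialX φ p
          = halfPhase p * (-Complex.I * partialX φ p) by ring]
        exact tX
      · rw [show -Complex.I * halfPhase p * partialY φ p
            = halfPhase p * (-Complex.I * ((1 : ℝ) * partialY φ p)) by
          push_cast
          ring]
        exact tY

/-! ### Equality of the sets of eigenvalues -/

/-- A function whose fold vanishes is odd under the gauged reflection in the first axis; if the
gauged reflection in the second axis has the same property, the function is also even, and so it
vanishes. -/
theorem ae_eq_zero_of_fold_eq_zero (h : SymmetricDomain Ω a b) {u : ℝ × ℝ → ℂ}
    (h1 : fold 1 1 u =ᵐ[volume.restrict (upperHalf Ω)] 0)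
    (h2 : fold 1 1 (fun p => phase p * u (reflectX p)) =ᵐ[volume.restrict (upperHalf Ω)] 0) :
    u =ᵐ[volume.restrict (Ω \ {0})] 0 := by
  have hm := h.isOpen_upperHalf.measurableSet
  have hX : reflectX ⁻¹' upperHalf Ω = upperHalf Ω := by
    ext p
    exact and_congr h.reflectX_mem Iff.rfl
  have mX : MeasurePreserving reflectX (volume.restrict (upperHalf Ω))
      (volume.restrict (upperHalf Ω)) := by
    have := measurePreserving_reflectX.restrict_preimage hm
    rwa [hX] at this
  -- The two folded functions vanish at `p` and at its mirror image, respectively: two independent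
  -- linear equations for `u p` and `u (reflectY p)`.
  have key : ∀ᵐ p ∂(volume.restrict (upperHalf Ω)), u p = 0 ∧ u (reflectY p) = 0 := by
    filter_upwards [h1, mX.quasiMeasurePreserving.ae h2, ae_restrict_mem hm] with p e1 e2 hp
    have hc : p ∈ cutPlane := Or.inr (ne_of_gt hp.2)
    have hpX : reflectX p ∈ cutPlane := Or.inr (ne_of_gt hp.2)
    have r1 : reflectX (reflectX p) = p := involutive_reflectX p
    have r2 : reflectX (reflectY (reflectX p)) = reflectY p := by
      simp [reflectX_apply, reflectY_apply]
    have r3 : reflectY (reflectX p) = -p := by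
      ext <;> simp [reflectX_apply, reflectY_apply]
    have n1 : halfPhase p ≠ 0 := fun h0 => by simpa [h0] using norm_halfPhase p
    have n2 : halfPhase (reflectX p) ≠ 0 := fun h0 => by
      simpa [h0] using norm_halfPhase (reflectX p)
    have c1 := conj_halfPhase_mul_self p
    have c2 := conj_halfPhase_mul_self (reflectX p)
    have s1 := halfPhase_mul_self p
    have s2 := halfPhase_mul_self (reflectX p)
    have hph : phase (reflectX p) = -conj (phase p) := by
      have : reflectX p = -(reflectY p) := by
        ext <;> simp [reflectX_apply, reflectY_apply]
      have hcY : reflectY p ≠ 0 := by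
        simpa using ne_zero_of_mem_cutPlane hc
      rw [this, phase_neg hcY, ← halfPhase_mul_self, reflectY_apply, halfPhase_reflect hc,
        ← map_mul, halfPhase_mul_self]
    have hph1 : phase p * conj (phase p) = 1 := by
      rw [Complex.mul_conj, Complex.normSq_eq_norm_sq, norm_phase]
      simp
    rw [fold_apply, Pi.zero_apply] at e1 e2
    have hY1 : halfPhase (reflectY p) = conj (halfPhase p) := halfPhase_reflect hc
    have hY2 : halfPhase (reflectY (reflectX p)) = conj (halfPhase (reflectX p)) :=
      halfPhase_reflect hpX
    simp only [r1, r2, hY1, hY2, one_mul, map_one, Complex.conj_conj] at e1 e2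
    rw [r3, phase_neg (ne_zero_of_mem_cutPlane hc)] at e2
    have q1 : u p + phase p * u (reflectY p) = 0 := by
      rw [← s1]
      linear_combination halfPhase p * e1 - u p * c1
    have q2 : phase (reflectX p) * (u p - phase p * u (reflectY p)) = 0 := by
      have : halfPhase (reflectX p) * (conj (halfPhase (reflectX p)) *
          (phase (reflectX p) * u p)
          + halfPhase (reflectX p) * (-phase p * u (reflectY p))) = 0 := by
        rw [e2, mul_zero]
      linear_combination this - phase (reflectX p) * u p * c2 + phase p * u (reflectY p) * s2
    have q3 : u p - phase p * u (reflectY p) = 0 := by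
      refine (mul_eq_zero.1 q2).resolve_left fun h0 => ?_
      simpa [h0] using norm_phase (reflectX p)
    have n3 : phase p ≠ 0 := fun h0 => by simpa [h0] using norm_phase p
    refine ⟨by linear_combination (q1 + q3) / 2, ?_⟩
    refine (mul_eq_zero.1 (?_ : phase p * u (reflectY p) = 0)).resolve_left n3
    linear_combination (q1 - q3) / 2
  have key1 := (ae_restrict_iff' hm).1 key
  have hmΩ : MeasurableSet (Ω \ {0}) := h.isOpen.measurableSet.diff (measurableSet_singleton 0)
  have key2 := measurePreserving_reflectY.quasiMeasurePreserving.ae key1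
  refine (ae_restrict_iff' hmΩ).2 ?_
  filter_upwards [key1, key2, ae_snd_ne_zero] with p k1 k2 hp0 hp
  rcases lt_or_gt_of_ne hp0 with hneg | hpos
  · have := (k2 ⟨h.reflectY_mem.2 hp.1, by
      show 0 < -p.2
      linarith⟩).2
    rwa [involutive_reflectY p] at this
  · exact (k1 ⟨hp.1, hpos⟩).1

/-- The mixed problem on the upper half, with the Neumann condition on the right half of the axis
segment, has the Aharonov–Bohm eigenvalues. -/
theorem mixedEigenvalues_upperHalf (h : SymmetricDomain Ω a b) :
    mixedEigenvalues (upperHalf Ω) (Ioc 0 (a / 2) ×ˢ {0}) = abEigenvalues Ω := by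
  have p0 := h.l2Pair_unfold (κ := 1) (s := 1) (by simp) (by simp)
  have p1 := h.l2Pair_unfold (κ := -Complex.I) (s := 1) (by simp) (by simp)
  have p2 := h.l2Pair_unfold (κ := -Complex.I) (s := -1) (by simp) (by simp)
  have hm := h.isOpen_upperHalf.measurableSet
  apply subset_antisymm
  · rintro z ⟨u, hu, H⟩
    refine ⟨unfold (upperHalf Ω) 1 1 u, fun h0 => hu ?_, ?_⟩
    · have h1 := ae_mono (Measure.restrict_mono upperHalf_subset le_rfl) h0
      filter_upwards [h1, ae_restrict_mem hm] with p hp hpD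
      rw [unfold_apply_of_pos hpD.1 hpD.2, one_mul, Pi.zero_apply] at hp
      refine (mul_eq_zero.1 hp).resolve_left fun h0 => ?_
      simpa [h0] using norm_halfPhase p
    · exact H.transfer p0 p1 p2 (coreMemLp_mixed _ _ _) (coreMemLp_magnetic _ _)
        (fun φ hφ => h.inFormClosure_unfold hφ) (fun ψ hψ => h.inFormClosure_fold hψ)
  · rintro z ⟨u, hu, H⟩
    have T : ∀ {v : ℝ × ℝ → ℂ}, IsFormOperator (Ω \ {0}) (testFunctions (Ω \ {0})) magneticX
        magneticY v (fun p => z * v p) → ¬ fold 1 1 v =ᵐ[volume.restrict (upperHalf Ω)] 0 →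
        z ∈ mixedEigenvalues (upperHalf Ω) (Ioc 0 (a / 2) ×ˢ {0}) := fun {v} hv hne =>
      ⟨fold 1 1 v, hne, hv.transfer p0.symm p1.symm p2.symm (coreMemLp_magnetic _ _)
        (coreMemLp_mixed _ _ _) (fun φ hφ => h.inFormClosure_fold hφ)
        (fun ψ hψ => h.inFormClosure_unfold hψ)⟩
    have HX := isFormOperator_magnetic_reflect h.isOpen.measurableSet (f := reflectX) (s := -1)
      (by simp) (fun p => by simp [reflectX_apply]) measurePreserving_reflectX
      involutive_reflectX H
    rw [h.reflectX_preimage] at HX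
    by_contra hz
    exact hu (h.ae_eq_zero_of_fold_eq_zero (not_not.1 fun hne => hz (T H hne))
      (not_not.1 fun hne => hz (T HX hne)))

theorem mixedEigenvalues_halves (h : SymmetricDomain Ω a b) :
    mixedEigenvalues (upperHalf Ω) (Ioc 0 (a / 2) ×ˢ {0}) = abEigenvalues Ω ∧
    mixedEigenvalues (upperHalf Ω) (Ico (-(a / 2)) 0 ×ˢ {0}) = abEigenvalues Ω ∧
    mixedEigenvalues (lowerHalf Ω) (Ioc 0 (a / 2) ×ˢ {0}) = abEigenvalues Ω ∧
    mixedEigenvalues (lowerHalf Ω) (Ico (-(a / 2)) 0 ×ˢ {0}) = abEigenvalues Ω := by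
  have hm := h.isOpen_upperHalf.measurableSet
  have rX := fun N => mixedEigenvalues_reflect (N := N) hm (f := reflectX) (s := -1) (by simp)
    (fun p => by simp [reflectX_apply]) measurePreserving_reflectX involutive_reflectX
  have rY := fun N => mixedEigenvalues_reflect (N := N) hm (f := reflectY) (s := 1) (by simp)
    (fun p => by simp [reflectY_apply]) measurePreserving_reflectY involutive_reflectY
  have eX : reflectX ⁻¹' upperHalf Ω = upperHalf Ω := by
    ext p
    exact and_congr h.reflectX_mem Iff.rfl
  have eY : reflectY ⁻¹' upperHalf Ω = lowerHalf Ω := by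
    ext p
    exact and_congr h.reflectY_mem (neg_pos (a := p.2))
  have nX : reflectX ⁻¹' (Ioc 0 (a / 2) ×ˢ {0}) = Ico (-(a / 2)) 0 ×ˢ {0} := by
    ext p
    simp only [mem_preimage, mem_prod, reflectX_apply, mem_Ioc, mem_Ico]
    refine and_congr ⟨fun H => ⟨by linarith [H.2], by linarith [H.1]⟩,
      fun H => ⟨by linarith [H.2], by linarith [H.1]⟩⟩ Iff.rfl
  have nY : ∀ I : Set ℝ, reflectY ⁻¹' (I ×ˢ {0}) = I ×ˢ {0} := fun I => by
    ext p
    simp [reflectY_apply]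
  have h1 := h.mixedEigenvalues_upperHalf
  have h2 := rX (Ioc 0 (a / 2) ×ˢ {0})
  rw [eX, nX, h1] at h2
  have h3 := rY (Ioc 0 (a / 2) ×ˢ {0})
  rw [eY, nY, h1] at h3
  have h4 := rY (Ico (-(a / 2)) 0 ×ˢ {0})
  rw [eY, nY, h2] at h4
  exact ⟨h1, h2, h3, h4⟩

end SymmetricDomain

theorem mainTheorem3 (Ω : Set (ℝ × ℝ)) (a b : ℝ) (ha : 0 < a) (hb : 0 < b)
    (hopen : IsOpen Ω) (hconv : Convex ℝ Ω)
    (hσ₁ : (fun p : ℝ × ℝ => (-p.1, p.2)) '' Ω = Ω)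
    (hσ₂ : (fun p : ℝ × ℝ => (p.1, -p.2)) '' Ω = Ω)
    (hx : Ω ∩ {p | p.2 = 0} = Set.Ioo (-(a / 2)) (a / 2) ×ˢ {0})
    (hy : Ω ∩ {p | p.1 = 0} = {0} ×ˢ Set.Ioo (-(b / 2)) (b / 2)) :
    mixedEigenvalues (upperHalf Ω) (Set.Ioc 0 (a / 2) ×ˢ {0}) = abEigenvalues Ω ∧
    mixedEigenvalues (upperHalf Ω) (Set.Ico (-(a / 2)) 0 ×ˢ {0}) = abEigenvalues Ω ∧
    mixedEigenvalues (lowerHalf Ω) (Set.Ioc 0 (a / 2) ×ˢ {0}) = abEigenvalues Ω ∧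
    mixedEigenvalues (lowerHalf Ω) (Set.Ico (-(a / 2)) 0 ×ˢ {0}) = abEigenvalues Ω ∧
    mixedEigenvalues (leftHalf Ω) ({0} ×ˢ Set.Ioc 0 (b / 2)) = abEigenvalues Ω ∧
    mixedEigenvalues (leftHalf Ω) ({0} ×ˢ Set.Ico (-(b / 2)) 0) = abEigenvalues Ω ∧
    mixedEigenvalues (rightHalf Ω) ({0} ×ˢ Set.Ioc 0 (b / 2)) = abEigenvalues Ω ∧
    mixedEigenvalues (rightHalf Ω) ({0} ×ˢ Set.Ico (-(b / 2)) 0) = abEigenvalues Ω := by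
  have h : SymmetricDomain Ω a b :=
    { pos_a := ha
      pos_b := hb
      isOpen := hopen
      convex := hconv
      reflectX_preimage := by
        conv_rhs => rw [← hσ₁]
        exact (congrFun (image_eq_preimage_of_inverse involutive_reflectX involutive_reflectX)
          Ω).symm
      reflectY_preimage := by
        conv_rhs => rw [← hσ₂]
        exact (congrFun (image_eq_preimage_of_inverse involutive_reflectY involutive_reflectY)
          Ω).symm
      mem_xAxis := fun x => by
        have := Set.ext_iff.1 hx (x, 0)
        simpa [abs_lt] using this
      mem_yAxis := fun y => by
        have := Set.ext_iff.1 hy (0, y)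
        simpa [abs_lt] using this }
  obtain ⟨u1, u2, l1, l2⟩ := h.mixedEigenvalues_halves
  obtain ⟨r1, r2, s1, s2⟩ := h.swap.mixedEigenvalues_halves
  rw [abEigenvalues_swap hopen.measurableSet] at r1 r2 s1 s2
  have mr : MeasurableSet (rightHalf Ω) :=
    (hopen.inter (isOpen_lt continuous_const continuous_fst)).measurableSet
  have ml : MeasurableSet (leftHalf Ω) :=
    (hopen.inter (isOpen_lt continuous_fst continuous_const)).measurableSet
  have n : ∀ I : Set ℝ, ContinuousLinearEquiv.prodComm ℝ ℝ ℝ ⁻¹' ({0} ×ˢ I) = I ×ˢ {0} :=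
    fun I => by
      ext p
      exact and_comm
  have er : ∀ I : Set ℝ, mixedEigenvalues (rightHalf Ω) ({0} ×ˢ I)
      = mixedEigenvalues (upperHalf (ContinuousLinearEquiv.prodComm ℝ ℝ ℝ ⁻¹' Ω)) (I ×ˢ {0}) :=
    fun I => by
      rw [← mixedEigenvalues_swap mr, n]
      rfl
  have el : ∀ I : Set ℝ, mixedEigenvalues (leftHalf Ω) ({0} ×ˢ I)
      = mixedEigenvalues (lowerHalf (ContinuousLinearEquiv.prodComm ℝ ℝ ℝ ⁻¹' Ω)) (I ×ˢ {0}) :=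
    fun I => by
      rw [← mixedEigenvalues_swap ml, n]
      rfl
  exact ⟨u1, u2, l1, l2, (el _).trans s1, (el _).trans s2, (er _).trans r1, (er _).trans r2⟩
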